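/- Let $H_1$ be a separable real Hilbert space, let $C[0,1]$ carry the supremum norm, let $\varrho\colon H_1\to C[0,1]$ be a bounded linear operator, and let $Y_k=\varrho(X_k)+\varepsilon_k$, $k\in\mathbb Z$, where $(Y_k,X_k)_{k\in\mathbb Z}$ is a strictly stationary process in $C[0,1]\times H_1$. For $a$ in a normed space and $b\in H_1$ write $a\otimes b$ for the operator $x\mapsto a\langle x,b\rangle$. Assume: (i) $(X_k)$ has mean zero and is $L^4$-$m$-approximable in $H_1$: $E\|X_k\|^4<\infty$, and $X_k=g(\delta_k,\delta_{k-1},\dots)$ a.s. for a measurable $g$ and i.i.d. $\delta_k$ with values in a measurable space, such that $\sum_{m\ge1}\big(E\|X_m-X_m^{(m)}\|^4\big)^{1/4}<\infty$, where $X_m^{(m)}=g(\delta_m,\dots,\delta_1,\delta_0',\delta_{-1}',\dots)$ and $(\delta_k')$ is an independent copy of $(\delta_k)$. (ii) $(\varepsilon_k)$ is an i.i.d. mean-zero sequence in $C[0,1]$ with $E\|\varepsilon_k\|_\infty^4<\infty$, and for every $k$, $\varepsilon_k$ is independent of $\big((X_j)_{j\le k},(\varepsilon_j)_{j<k}\big)$.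 (iii) For some $0<\alpha\le1$ and every $k$ there is a positive random variable $M_k$, independent of $X_k$, with $E M_k^2<\infty$ such that a.s. $|\varepsilon_k(t)-\varepsilon_k(s)|<M_k|t-s|^\alpha$ for all $t\ne s$ in $[0,1]$; and there is a finite constant $M_\varrho$ with $|\varrho x(t)-\varrho x(s)|\le M_\varrho\|x\|\,|t-s|^\alpha$ for all $x\in H_1$ and $s,t\in[0,1]$. Let $m_n>0$ with $m_n\to\infty$ and $m_n=o(n^{\alpha/2})$. Let $\widehat C_{XX}=\frac1n\sum_{k=1}^nX_k\otimes X_k$ and $\widehat C_{YX}=\frac1n\sum_{k=1}^nY_k\otimes X_k$; let $\hat\lambda_1\ge\hat\lambda_2\ge\dots\ge0$ be the eigenvalues of $\widehat C_{XX}$ (with multiplicity, continued by zeros if necessary) with any choice of orthonormal eigenvectors $\hat v_i$; let $T_n=\max\{j\ge1:\hat\lambda_j\ge m_n^{-1}\}$ ($T_n=0$ if there is no such $j$) and $$\hat\varrho_n=\sum_{i=1}^{T_n}\frac1{\hat\lambda_i}\,\widehat C_{YX}\,\hat v_i\otimes\hat v_i .$$ Put $\hat\varepsilon_{k,n}=Y_k-\hat\varrho_n(X_k)$,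 $\bar\varepsilon_{\cdot,n}=\frac1n\sum_{k=1}^n\hat\varepsilon_{k,n}$, $\widehat\Gamma_{\varepsilon,n}(t,s)=\frac1n\sum_{k=1}^n(\hat\varepsilon_{k,n}-\bar\varepsilon_{\cdot,n})(t)\,(\hat\varepsilon_{k,n}-\bar\varepsilon_{\cdot,n})(s)$ and $V_n^2(t,s)=\widehat\Gamma_{\varepsilon,n}(t,t)-2\widehat\Gamma_{\varepsilon,n}(t,s)+\widehat\Gamma_{\varepsilon,n}(s,s)$. Then: (a) As $n\to\infty$, $$\sup_{t,s\in[0,1]}\Big|\frac1n\sum_{k=1}^n(\hat\varrho_n-\varrho)(X_k)(t)\,(\hat\varrho_n-\varrho)(X_k)(s)\Big|\xrightarrow{P}0 .$$ (b) There is a positive random variable $M_V$ with $E M_V<\infty$ such that, almost surely, $V_n^2(t,s)<M_V^2\,|t-s|^{2\alpha}$ for all $n\ge1$ and all $t\ne s$ in $[0,1]$. -/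

import Mathlib

open MeasureTheory ProbabilityTheory Filter Topology

noncomputable section

/-- The Borel sigma-algebra on `C[0,1]` with the supremum norm. -/
instance instMeasurableSpaceCUnit : MeasurableSpace C(unitInterval, ℝ) := borel _

instance instBorelSpaceCUnit : BorelSpace C(unitInterval, ℝ) := ⟨rfl⟩

namespace FReg

/-- The operator `a ⊗ b : x ↦ ⟪b, x⟫ a`. -/
def tensorOp {H F : Type*} [NormedAddCommGroup H] [InnerProductSpace ℝ H]
    [NormedAddCommGroup F] [NormedSpace ℝ F] (a : F) (b : H) : H →L[ℝ] F :=
  (innerSL ℝ b).smulRight a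

/-- Empirical (cross-)covariance operator `(1/n) ∑_{k=1}^n y_k ⊗ x_k` of the data
`(y_1, x_1), …, (y_n, x_n)`. -/
def empCov {H F : Type*} [NormedAddCommGroup H] [InnerProductSpace ℝ H]
    [NormedAddCommGroup F] [NormedSpace ℝ F] (y : ℤ → F) (x : ℤ → H) (n : ℕ) : H →L[ℝ] F :=
  (n : ℝ)⁻¹ • ∑ k ∈ Finset.Icc (1 : ℤ) n, tensorOp (y k) (x k)

/-- An eigensystem of a nonnegative operator `C`: the eigenvalues `val 0 ≥ val 1 ≥ … ≥ 0`, listed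
with multiplicity (and continued by zeros when the list of nonzero eigenvalues is finite), with
eigenvectors which are orthonormal and exhaust `C`. Eigenvectors are normalized only for the
nonzero eigenvalues, so that finite-dimensional spaces are included.
The `j`-th largest eigenvalue, `j ≥ 1`, is `val (j - 1)`. -/
structure EigenSystem {H : Type*} [NormedAddCommGroup H] [InnerProductSpace ℝ H]
    (C : H →L[ℝ] H) where
  val : ℕ → ℝ
  vec : ℕ → H
  val_nonneg : ∀ i, 0 ≤ val i
  val_antitone : Antitone val
  orthonormal : Orthonormal ℝ (fun i : {i : ℕ // val i ≠ 0} => vec i)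
  apply_vec : ∀ i, val i ≠ 0 → C (vec i) = val i • vec i
  hasSum : ∀ x, HasSum (fun i => val i • tensorOp (vec i) (vec i) x) (C x)

theorem empCov_apply {H : Type*} [NormedAddCommGroup H] [InnerProductSpace ℝ H]
    (x : ℤ → H) (n : ℕ) (z : H) :
    empCov x x n z = (n : ℝ)⁻¹ • ∑ k ∈ Finset.Icc (1 : ℤ) n, (inner ℝ (x k) z) • x k := by
  simp [empCov, tensorOp]

/-- Every empirical covariance operator has an eigensystem. -/
instance nonempty_eigenSystem {H : Type*} [NormedAddCommGroup H] [InnerProductSpace ℝ H]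
    (x : ℤ → H) (n : ℕ) : Nonempty (EigenSystem (empCov x x n)) := by
  classical
  set C := empCov x x n with hC
  let U : Submodule ℝ H := Submodule.span ℝ (x '' (Finset.Icc (1 : ℤ) n : Set ℤ))
  have : FiniteDimensional ℝ U :=
    FiniteDimensional.span_of_finite ℝ ((Finset.finite_toSet _).image _)
  have hxU : ∀ k ∈ Finset.Icc (1 : ℤ) n, x k ∈ U := fun k hk =>
    Submodule.subset_span ⟨k, hk, rfl⟩
  have hCU : ∀ z, C z ∈ U := fun z => by
    rw [hC, empCov_apply]
    exact U.smul_mem _ (U.sum_mem fun k hk => U.smul_mem _ (hxU k hk))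
  have hinner : ∀ z w, inner ℝ (C z) w
      = (n : ℝ)⁻¹ * ∑ k ∈ Finset.Icc (1 : ℤ) n, inner ℝ (x k) z * inner ℝ (x k) w := fun z w => by
    rw [hC, empCov_apply, real_inner_smul_left, sum_inner]
    simp_rw [real_inner_smul_left]
  let A : U →ₗ[ℝ] U := ((C : H →ₗ[ℝ] H).comp U.subtype).codRestrict U fun z => hCU z
  have hA : ∀ u : U, ((A u : U) : H) = C u := fun u => rfl
  have hsym : A.IsSymmetric := fun u w => by
    rw [Submodule.coe_inner, Submodule.coe_inner, hA, hA, hinner, real_inner_comm, hinner]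
    simp_rw [mul_comm]
  let d := Module.finrank ℝ U
  let lam := hsym.eigenvalues (n := d) rfl
  let b := hsym.eigenvectorBasis (n := d) rfl
  have hb : ∀ i, C (b i : H) = lam i • (b i : H) := fun i => by
    have h := congrArg (fun u : U => (u : H)) (hsym.apply_eigenvectorBasis (n := d) rfl i)
    rw [hA] at h
    exact h
  have hlam : ∀ i, 0 ≤ lam i := fun i => by
    have h1 : inner ℝ (C (b i : H)) (b i : H) = lam i := by
      rw [hb, real_inner_smul_left, ← Submodule.coe_inner, b.inner_eq_one, mul_one]
    rw [← h1, hinner]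
    exact mul_nonneg (by positivity) (Finset.sum_nonneg fun k _ => mul_self_nonneg _)
  let val : ℕ → ℝ := fun i => if h : i < d then lam ⟨i, h⟩ else 0
  let vec : ℕ → H := fun i => if h : i < d then (b ⟨i, h⟩ : H) else 0
  have hlt : ∀ i, val i ≠ 0 → i < d := fun i hi => by
    by_contra h
    exact hi (dif_neg h)
  have hval : ∀ i (h : i < d), val i = lam ⟨i, h⟩ := fun i h => dif_pos h
  have hvec : ∀ i (h : i < d), vec i = (b ⟨i, h⟩ : H) := fun i h => dif_pos h
  have hproj : ∀ z, C z = C (U.starProjection z) := fun z => by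
    rw [hC, empCov_apply, empCov_apply]
    congr 1
    refine Finset.sum_congr rfl fun k hk => ?_
    congr 1
    have h := U.starProjection_inner_eq_zero z (x k) (hxU k hk)
    rw [inner_sub_left, sub_eq_zero] at h
    rw [real_inner_comm, h, real_inner_comm]
  refine ⟨⟨val, vec, fun i => ?_, ?_, ?_, fun i hi => ?_, fun z => ?_⟩⟩
  · by_cases h : i < d
    · rw [hval i h]; exact hlam _
    · have : val i = 0 := dif_neg h
      exact this.ge
  · intro i j hij
    by_cases h : j < d
    · rw [hval j h, hval i (hij.trans_lt h)]
      exact hsym.eigenvalues_antitone rfl hij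
    · have : val j = 0 := dif_neg h
      rw [this]
      by_cases h' : i < d
      · rw [hval i h']; exact hlam _
      · have : val i = 0 := dif_neg h'
        exact this.ge
  · have h := (b.orthonormal.comp_linearIsometry U.subtypeₗᵢ).comp
      (fun i : {i : ℕ // val i ≠ 0} => (⟨i, hlt i i.2⟩ : Fin d))
      (fun i j hij => Subtype.ext (by simpa using hij))
    convert h using 1
    ext i
    exact hvec i (hlt i i.2)
  · rw [hval i (hlt i hi), hvec i (hlt i hi), hb]
  · have h0 : ∀ i ∉ Finset.range d, val i • tensorOp (vec i) (vec i) z = 0 := fun i hi => by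
      have : val i = 0 := dif_neg (by simpa using hi)
      rw [this, zero_smul]
    suffices h : C z = ∑ i ∈ Finset.range d, val i • tensorOp (vec i) (vec i) z by
      rw [h]
      exact hasSum_sum_of_ne_finset_zero h0
    rw [Finset.sum_range, hproj z]
    have h1 := congrArg (fun u : U => (u : H)) (b.sum_repr' (U.orthogonalProjectionOnto z))
    simp only [Submodule.coe_sum, Submodule.coe_smul] at h1
    rw [Submodule.starProjection_apply, ← h1, map_sum]
    refine Finset.sum_congr rfl fun i _ => ?_
    rw [hval i i.2, hvec i i.2, map_smul, hb, smul_comm]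
    simp [tensorOp]

/-- `T = max {j ≥ 1 : λ_j ≥ 1 / m}`, and `T = 0` when there is no such `j`. -/
def truncation {H : Type*} [NormedAddCommGroup H] [InnerProductSpace ℝ H]
    {C : H →L[ℝ] H} (E : EigenSystem C) (m : ℝ) : ℕ :=
  sSup {j : ℕ | 1 ≤ j ∧ m⁻¹ ≤ E.val (j - 1)}

/-- The estimator `∑_{i=1}^{T} λ_i⁻¹ C_{YX} (v_i ⊗ v_i)` with `T` selected by the threshold
`1 / m`, from the data `(y_1, x_1), …, (y_n, x_n)`. -/
def fpcaEstimator {H F : Type*} [NormedAddCommGroup H] [InnerProductSpace ℝ H]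
    [NormedAddCommGroup F] [NormedSpace ℝ F] (y : ℤ → F) (x : ℤ → H) (n : ℕ)
    (E : EigenSystem (empCov x x n)) (m : ℝ) : H →L[ℝ] F :=
  ∑ i ∈ Finset.range (truncation E m),
    (E.val i)⁻¹ • (empCov y x n).comp (tensorOp (E.vec i) (E.vec i))

/-- The kernel `(1/n) ∑_{k=1}^n (r - ρ)(x_k) ⊗ (r - ρ)(x_k)` at `(t, s)`. -/
def errorKernel {H : Type*} [NormedAddCommGroup H] [InnerProductSpace ℝ H]
    (r ρ : H →L[ℝ] C(unitInterval, ℝ)) (x : ℤ → H) (n : ℕ) (t s : unitInterval) : ℝ :=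
  (n : ℝ)⁻¹ * ∑ k ∈ Finset.Icc (1 : ℤ) n, (r - ρ) (x k) t * (r - ρ) (x k) s

/-- The residual `y_k - r x_k` of the fit `r`. -/
def residual {H : Type*} [NormedAddCommGroup H] [InnerProductSpace ℝ H]
    (r : H →L[ℝ] C(unitInterval, ℝ)) (y : ℤ → C(unitInterval, ℝ)) (x : ℤ → H) (k : ℤ) :
    C(unitInterval, ℝ) :=
  y k - r (x k)

/-- The mean of the first `n` residuals. -/
def residualMean {H : Type*} [NormedAddCommGroup H] [InnerProductSpace ℝ H]
    (r : H →L[ℝ] C(unitInterval, ℝ)) (y : ℤ → C(unitInterval, ℝ)) (x : ℤ → H) (n : ℕ) :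
    C(unitInterval, ℝ) :=
  (n : ℝ)⁻¹ • ∑ k ∈ Finset.Icc (1 : ℤ) n, residual r y x k

/-- The kernel of the empirical covariance operator of the first `n` centred residuals. -/
def residualCov {H : Type*} [NormedAddCommGroup H] [InnerProductSpace ℝ H]
    (r : H →L[ℝ] C(unitInterval, ℝ)) (y : ℤ → C(unitInterval, ℝ)) (x : ℤ → H) (n : ℕ)
    (t s : unitInterval) : ℝ :=
  (n : ℝ)⁻¹ * ∑ k ∈ Finset.Icc (1 : ℤ) n,
    (residual r y x k - residualMean r y x n) t * (residual r y x k - residualMean r y x n) s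

/-- The estimated variance of the increment of the model error between `s` and `t`. -/
def incrementVar {H : Type*} [NormedAddCommGroup H] [InnerProductSpace ℝ H]
    (r : H →L[ℝ] C(unitInterval, ℝ)) (y : ℤ → C(unitInterval, ℝ)) (x : ℤ → H) (n : ℕ)
    (t s : unitInterval) : ℝ :=
  residualCov r y x n t t - 2 * residualCov r y x n t s + residualCov r y x n s s

/-- `L^p`-`m`-approximability: `X_k = g(δ_k, δ_{k-1}, …)` with i.i.d. innovations `δ_k` in `S`
and measurable `g`, `X_k ∈ L^p`, and, with `δ'` an independent copy of the innovations,
`∑_{m ≥ 1} ‖X_m - g(δ_m, …, δ_1, δ'_0, δ'_{-1}, …)‖_{L^p} < ∞`. The `L^p`-norms depend only on the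
joint law of `δ` and `δ'`, so they are computed under the product law. -/
def IsLpMApproximable {Ω H : Type*} [MeasurableSpace Ω] [NormedAddCommGroup H] [MeasurableSpace H]
    (S : Type*) [MeasurableSpace S] (X : ℤ → Ω → H) (p : ENNReal) (P : Measure Ω) : Prop :=
  (∀ k, MemLp (X k) p P) ∧
  ∃ (δ : ℤ → Ω → S) (ν : ProbabilityMeasure S) (g : (ℕ → S) → H),
    Measurable g ∧ (∀ k, Measurable (δ k)) ∧ iIndepFun δ P ∧
    (∀ k, P.map (δ k) = (ν : Measure S)) ∧
    (∀ k, ∀ᵐ ω ∂P, X k ω = g (fun j => δ (k - j) ω)) ∧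
    ∑' m : ℕ, eLpNorm
      (fun w : (ℕ → S) × (ℕ → S) => g w.1 - g (fun j => if j < m + 1 then w.1 j else w.2 j)) p
      ((Measure.infinitePi fun _ : ℕ => (ν : Measure S)).prod
        (Measure.infinitePi fun _ : ℕ => (ν : Measure S))) < ⊤

/-- The functional linear model `Y_k = ρ X_k + ε_k`, a strictly stationary process `(Y_k, X_k)`,
with each `ε_k` independent of the current and past covariates and of the past errors. -/
structure LinearModel {Ω H : Type*} [MeasurableSpace Ω] [NormedAddCommGroup H]
    [InnerProductSpace ℝ H] [MeasurableSpace H] (P : Measure Ω)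
    (ρ : H →L[ℝ] C(unitInterval, ℝ)) (X : ℤ → Ω → H) (Y ε : ℤ → Ω → C(unitInterval, ℝ)) :
    Prop where
  measurable_X : ∀ k, Measurable (X k)
  measurable_Y : ∀ k, Measurable (Y k)
  measurable_ε : ∀ k, Measurable (ε k)
  model : ∀ k, ∀ᵐ ω ∂P, Y k ω = ρ (X k ω) + ε k ω
  stationary : ∀ h : ℤ, IdentDistrib (fun ω (k : ℤ) => (Y (k + h) ω, X (k + h) ω))
    (fun ω (k : ℤ) => (Y k ω, X k ω)) P P
  indep : ∀ k, IndepFun (ε k)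
    (fun ω => ((fun j : Set.Iic k => X j ω), (fun j : Set.Iio k => ε j ω))) P

/-- Moment and dependence conditions on covariates and errors: `X` is centred and
`L^4`-`m`-approximable, `ε` is centred, i.i.d. and has a finite fourth moment. -/
structure HilbertSetting {Ω H : Type*} [MeasurableSpace Ω] [NormedAddCommGroup H]
    [InnerProductSpace ℝ H] [MeasurableSpace H] (S : Type*) [MeasurableSpace S] (P : Measure Ω)
    (X : ℤ → Ω → H) (ε : ℤ → Ω → C(unitInterval, ℝ)) : Prop where
  approximable : IsLpMApproximable S X 4 P
  mean_X : ∀ k, ∫ ω, X k ω ∂P = 0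
  iIndep_ε : iIndepFun ε P
  identDistrib_ε : ∀ k, IdentDistrib (ε k) (ε 0) P P
  memLp_ε : ∀ k, MemLp (ε k) 4 P
  mean_ε : ∀ k, ∫ ω, ε k ω ∂P = 0

/-- Hölder conditions of order `α` on the errors and on the regression operator. -/
structure HolderSetting {Ω H : Type*} [MeasurableSpace Ω] [NormedAddCommGroup H]
    [InnerProductSpace ℝ H] [MeasurableSpace H] (P : Measure Ω)
    (ρ : H →L[ℝ] C(unitInterval, ℝ)) (X : ℤ → Ω → H) (ε : ℤ → Ω → C(unitInterval, ℝ))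
    (α : ℝ) : Prop where
  errors : ∃ M : ℤ → Ω → ℝ, ∀ k, Measurable (M k) ∧ (∀ ω, 0 < M k ω) ∧
    IndepFun (M k) (X k) P ∧ Integrable (fun ω => M k ω ^ 2) P ∧
    ∀ᵐ ω ∂P, ∀ t s : unitInterval, t ≠ s →
      |ε k ω t - ε k ω s| < M k ω * |(t : ℝ) - s| ^ α
  operator : ∃ Mρ : ℝ, ∀ (x : H) (t s : unitInterval),
    |ρ x t - ρ x s| ≤ Mρ * ‖x‖ * |(t : ℝ) - s| ^ α

end FReg

end

/-! At a fixed `t`, the fitted values of the estimator are the least squares fit of the responses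
`y_k(t)` on the retained principal component scores `⟨v_i, x_k⟩`. These scores are orthogonal for
the empirical inner product `(1/n) ∑_k`, with squared norms `λ_i`, so fitting is an orthogonal
projection that is linear in the response. Neither consistency of the eigenvectors nor a spectral
gap is needed.

For (a), `2|ab| ≤ a² + b²` reduces the supremum over pairs to the diagonal. The prediction error at
`t` is the fit of the noise `ε_k(t)` minus the part of `ρ(X_k)(t)` that the projection misses.
Discarded eigenvalues are below `1/m`, so the missed part has empirical second moment at most
`‖ρ‖²/m` (`mul_sum_inner_sub_fit_sq_le`). Retained ones are at least `1/m`, so the fitted noise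
contributes at most `m ‖(1/n) ∑ ε_k(t) X_k‖²` (`mul_sum_fit_sq_le`). The summands `ε_k(t) X_k` are
orthogonal in `L²`, so the expected square is `O(1/n)` at each `t`. A grid of mesh `1/N` and the
Hölder condition give a bound uniform in `t` with mean `O(N/n + N^(-2α))`. With `N` of order `√n`
this is `O(n^(-α/2))`, which multiplied by `m_n` tends to zero.

For (b), centring and projecting are contractions, so the increment variance is at most `(1/n) ∑
(Y_k(t) - Y_k(s))²`, hence at most `|t - s|^(2α)` times the average of the squared Hölder constants
of the `Y_k`. Those squares are stationary and integrable. The maximal ergodic inequality bounds the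
probability that some average exceeds `c` by a multiple of `1/c`; the square root of the supremum
therefore has tail `O(u⁻²)` and is integrable. -/

noncomputable section

namespace FReg

/-! ### Least squares projections on finitely many orthogonal regressors -/

section LeastSquares

variable {ι κ : Type*} (K : Finset ι) (s : Finset κ) (c : ℝ) (u : κ → ι → ℝ) (lam : κ → ℝ)

/-- The fitted values of the regression of `y` on the orthogonal regressors `u i`, `i ∈ s`, whose
weighted squared norms are `lam i`. -/
def lsFit (y : ι → ℝ) (k : ι) : ℝ :=
  ∑ i ∈ s, (lam i)⁻¹ * (c * ∑ j ∈ K, y j * u i j) * u i k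

theorem lsFit_add (y z : ι → ℝ) (k : ι) :
    lsFit K s c u lam (fun j => y j + z j) k = lsFit K s c u lam y k + lsFit K s c u lam z k := by
  simp only [lsFit, ← Finset.sum_add_distrib]
  refine Finset.sum_congr rfl fun i _ => ?_
  simp only [add_mul, Finset.sum_add_distrib, mul_add]

theorem lsFit_sub (y z : ι → ℝ) (k : ι) :
    lsFit K s c u lam (fun j => y j - z j) k = lsFit K s c u lam y k - lsFit K s c u lam z k := by
  simp only [lsFit, ← Finset.sum_sub_distrib]
  refine Finset.sum_congr rfl fun i _ => ?_
  simp only [sub_mul, Finset.sum_sub_distrib, mul_sub]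

/-- The right side is symmetric in `y` and `z`: fitting is self-adjoint for the empirical inner
product, even before orthogonality is used. -/
theorem mul_sum_mul_lsFit (y z : ι → ℝ) :
    c * ∑ k ∈ K, z k * lsFit K s c u lam y k
      = ∑ i ∈ s, (lam i)⁻¹ * (c * ∑ j ∈ K, y j * u i j) * (c * ∑ j ∈ K, z j * u i j) := by
  have h : ∀ k, z k * lsFit K s c u lam y k
      = ∑ i ∈ s, z k * ((lam i)⁻¹ * (c * ∑ j ∈ K, y j * u i j) * u i k) :=
    fun k => Finset.mul_sum _ _ _
  simp_rw [h]
  rw [Finset.sum_comm, Finset.mul_sum]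
  refine Finset.sum_congr rfl fun i _ => ?_
  generalize c * ∑ j ∈ K, y j * u i j = b
  rw [Finset.mul_sum, Finset.mul_sum, Finset.mul_sum]
  refine Finset.sum_congr rfl fun k _ => ?_
  ring

variable {K s c u lam} [DecidableEq κ]

/-- Normal equations: by self-adjointness and orthogonality only the `i`-th term survives. -/
theorem mul_sum_lsFit_mul (hne : ∀ i ∈ s, lam i ≠ 0)
    (orth : ∀ i ∈ s, ∀ j ∈ s, c * ∑ k ∈ K, u i k * u j k = if i = j then lam j else 0)
    (y : ι → ℝ) {i : κ} (hi : i ∈ s) :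
    c * ∑ j ∈ K, lsFit K s c u lam y j * u i j = c * ∑ j ∈ K, y j * u i j := by
  simp_rw [mul_comm (lsFit K s c u lam y _)]
  rw [mul_sum_mul_lsFit]
  rw [Finset.sum_eq_single i]
  · have h := orth i hi i hi
    rw [if_pos rfl] at h
    rw [h, mul_right_comm, inv_mul_cancel₀ (hne i hi), one_mul]
  · intro j hj hji
    rw [orth i hi j hj, if_neg (Ne.symm hji), mul_zero]
  · exact fun h => absurd hi h

theorem mul_sum_lsFit_sq (hne : ∀ i ∈ s, lam i ≠ 0)
    (orth : ∀ i ∈ s, ∀ j ∈ s, c * ∑ k ∈ K, u i k * u j k = if i = j then lam j else 0)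
    (y : ι → ℝ) :
    c * ∑ k ∈ K, lsFit K s c u lam y k ^ 2
      = ∑ i ∈ s, (lam i)⁻¹ * (c * ∑ j ∈ K, y j * u i j) ^ 2 := by
  simp_rw [sq (lsFit K s c u lam y _)]
  rw [mul_sum_mul_lsFit]
  refine Finset.sum_congr rfl fun i hi => ?_
  rw [mul_sum_lsFit_mul hne orth y hi]
  ring

/-- Pythagoras for the projection; it yields both the contraction property and the exact size of the
bias. -/
theorem mul_sum_sub_lsFit_sq (hne : ∀ i ∈ s, lam i ≠ 0)
    (orth : ∀ i ∈ s, ∀ j ∈ s, c * ∑ k ∈ K, u i k * u j k = if i = j then lam j else 0)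
    (y : ι → ℝ) :
    c * ∑ k ∈ K, (y k - lsFit K s c u lam y k) ^ 2
      = c * ∑ k ∈ K, y k ^ 2 - ∑ i ∈ s, (lam i)⁻¹ * (c * ∑ j ∈ K, y j * u i j) ^ 2 := by
  have h1 := mul_sum_lsFit_sq hne orth y
  have h2 := mul_sum_mul_lsFit K s c u lam y y
  have h3 : ∀ k, (y k - lsFit K s c u lam y k) ^ 2
      = y k ^ 2 - 2 * (y k * lsFit K s c u lam y k) + lsFit K s c u lam y k ^ 2 := fun k => by ring
  simp_rw [h3, Finset.sum_add_distrib, Finset.sum_sub_distrib, ← Finset.mul_sum]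
  rw [mul_add, mul_sub, h1, mul_left_comm, h2]
  simp_rw [mul_assoc _ (c * ∑ j ∈ K, y j * _), ← sq]
  ring

end LeastSquares

/-! ### The estimator as a least squares projection -/

section Estimator

variable {H : Type*} [NormedAddCommGroup H] [InnerProductSpace ℝ H]

theorem inner_empCov (x : ℤ → H) (n : ℕ) (z w : H) :
    inner ℝ (empCov x x n z) w
      = (n : ℝ)⁻¹ * ∑ k ∈ Finset.Icc (1 : ℤ) n, inner ℝ z (x k) * inner ℝ w (x k) := by
  rw [empCov_apply, real_inner_smul_left, sum_inner]
  simp_rw [real_inner_smul_left, real_inner_comm (x _)]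

namespace EigenSystem

variable {x : ℤ → H} {n : ℕ} (E : EigenSystem (empCov x x n))

theorem mul_sum_inner_vec_mul (z : H) {i : ℕ} (hi : E.val i ≠ 0) :
    (n : ℝ)⁻¹ * ∑ k ∈ Finset.Icc (1 : ℤ) n, inner ℝ z (x k) * inner ℝ (E.vec i) (x k)
      = E.val i * inner ℝ (E.vec i) z := by
  simp_rw [mul_comm (inner ℝ z (x _))]
  rw [← inner_empCov, E.apply_vec i hi, real_inner_smul_left]

theorem inner_vec {i j : ℕ} (hi : E.val i ≠ 0) (hj : E.val j ≠ 0) :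
    inner ℝ (E.vec i) (E.vec j) = if i = j then (1 : ℝ) else 0 := by
  have h := orthonormal_iff_ite.1 E.orthonormal ⟨i, hi⟩ ⟨j, hj⟩
  simpa [Subtype.ext_iff] using h

theorem sum_inner_vec_sq_le (s : Finset ℕ) (hs : ∀ i ∈ s, E.val i ≠ 0) (z : H) :
    ∑ i ∈ s, inner ℝ (E.vec i) z ^ 2 ≤ ‖z‖ ^ 2 := by
  have h := E.orthonormal.sum_inner_products_le z (s := s.subtype fun i => E.val i ≠ 0)
  refine le_trans (le_of_eq ?_) h
  rw [Finset.sum_subtype_of_mem (f := fun i => ‖inner ℝ (E.vec i) z‖ ^ 2) hs]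
  simp

/-- Trace bound: an eigenvalue is the empirical mean square of its score, and Bessel bounds the
squared scores of each `x k`. -/
theorem sum_val_le (N : ℕ) (hN : ∀ i < N, E.val i ≠ 0) :
    ∑ i ∈ Finset.range N, E.val i ≤ (n : ℝ)⁻¹ * ∑ k ∈ Finset.Icc (1 : ℤ) n, ‖x k‖ ^ 2 := by
  have h : ∀ i ∈ Finset.range N, E.val i
      = (n : ℝ)⁻¹ * ∑ k ∈ Finset.Icc (1 : ℤ) n, inner ℝ (E.vec i) (x k) ^ 2 := fun i hi => by
    have hi' := hN i (Finset.mem_range.1 hi)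
    simp_rw [sq]
    rw [E.mul_sum_inner_vec_mul _ hi', E.inner_vec hi' hi', if_pos rfl, mul_one]
  rw [Finset.sum_congr rfl h, ← Finset.mul_sum, Finset.sum_comm]
  gcongr with k hk
  exact E.sum_inner_vec_sq_le _ (fun i hi => hN i (Finset.mem_range.1 hi)) _

/-- By the trace bound only finitely many eigenvalues reach `1 / m`. Without this the `sSup`
defining `truncation` could be a default value. -/
theorem bddAbove_le_val {m : ℝ} (hm : 0 < m) :
    BddAbove {j : ℕ | 1 ≤ j ∧ m⁻¹ ≤ E.val (j - 1)} := by
  set B := (n : ℝ)⁻¹ * ∑ k ∈ Finset.Icc (1 : ℤ) n, ‖x k‖ ^ 2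
  refine ⟨⌈m * B⌉₊, fun j hj => ?_⟩
  have hval : ∀ i < j, m⁻¹ ≤ E.val i := fun i hi =>
    hj.2.trans (E.val_antitone (Nat.le_sub_one_of_lt hi))
  have hpos : 0 < m⁻¹ := inv_pos.2 hm
  have h1 := E.sum_val_le j fun i hi => (hpos.trans_le (hval i hi)).ne'
  have h2 : (j : ℝ) * m⁻¹ ≤ B := by
    refine le_trans ?_ h1
    have := Finset.card_nsmul_le_sum (Finset.range j) E.val m⁻¹
      fun i hi => hval i (Finset.mem_range.1 hi)
    simpa using this
  have h3 : (j : ℝ) ≤ m * B := by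
    rw [← div_eq_mul_inv, div_le_iff₀ hm] at h2
    linarith
  exact_mod_cast h3.trans (Nat.le_ceil _)

theorem inv_le_val_of_lt_truncation {m : ℝ} (hm : 0 < m) {i : ℕ} (hi : i < truncation E m) :
    m⁻¹ ≤ E.val i := by
  have hne : {j : ℕ | 1 ≤ j ∧ m⁻¹ ≤ E.val (j - 1)}.Nonempty := by
    -- An empty set has `sSup` equal to `0`, which leaves no `i` below it.
    by_contra h
    rw [Set.not_nonempty_iff_eq_empty] at h
    rw [truncation, h, csSup_empty] at hi
    exact absurd hi (Nat.not_lt_zero i)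
  have h := Nat.sSup_mem hne (E.bddAbove_le_val hm)
  exact h.2.trans (E.val_antitone (Nat.le_sub_one_of_lt hi))

theorem val_lt_inv_of_truncation_le {m : ℝ} (hm : 0 < m) {i : ℕ} (hi : truncation E m ≤ i) :
    E.val i < m⁻¹ := by
  by_contra! h
  have h1 : i + 1 ≤ truncation E m := le_csSup (E.bddAbove_le_val hm) ⟨by omega, by simpa using h⟩
  omega

/-- The fitted values of the regression of `y` on the principal component scores of `x`. -/
def fit (m : ℝ) (y : ℤ → ℝ) (k : ℤ) : ℝ :=
  lsFit (Finset.Icc (1 : ℤ) n) (Finset.range (truncation E m)) (n : ℝ)⁻¹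
    (fun i k => inner ℝ (E.vec i) (x k)) E.val y k

variable {m : ℝ}

theorem fit_add (m : ℝ) (y z : ℤ → ℝ) (k : ℤ) :
    E.fit m (fun j => y j + z j) k = E.fit m y k + E.fit m z k :=
  lsFit_add _ _ _ _ _ y z k

theorem fit_sub (m : ℝ) (y z : ℤ → ℝ) (k : ℤ) :
    E.fit m (fun j => y j - z j) k = E.fit m y k - E.fit m z k :=
  lsFit_sub _ _ _ _ _ y z k

theorem val_ne_zero_of_mem (hm : 0 < m) : ∀ i ∈ Finset.range (truncation E m), E.val i ≠ 0 :=
  fun _ hi =>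
    ((inv_pos.2 hm).trans_le (E.inv_le_val_of_lt_truncation hm (Finset.mem_range.1 hi))).ne'

theorem scores_orthogonal (hm : 0 < m) :
    ∀ i ∈ Finset.range (truncation E m), ∀ j ∈ Finset.range (truncation E m),
      (n : ℝ)⁻¹ * ∑ k ∈ Finset.Icc (1 : ℤ) n, inner ℝ (E.vec i) (x k) * inner ℝ (E.vec j) (x k)
        = if i = j then E.val j else 0 := fun i hi j hj => by
  have hi' := E.val_ne_zero_of_mem hm i hi
  have hj' := E.val_ne_zero_of_mem hm j hj
  rw [E.mul_sum_inner_vec_mul _ hj', E.inner_vec hj' hi']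
  simp [eq_comm]

theorem mul_sum_sub_fit_sq_le (hm : 0 < m) (y : ℤ → ℝ) :
    (n : ℝ)⁻¹ * ∑ k ∈ Finset.Icc (1 : ℤ) n, (y k - E.fit m y k) ^ 2
      ≤ (n : ℝ)⁻¹ * ∑ k ∈ Finset.Icc (1 : ℤ) n, y k ^ 2 := by
  have h := mul_sum_sub_lsFit_sq (E.val_ne_zero_of_mem hm) (E.scores_orthogonal hm) y
  unfold fit
  rw [h]
  exact sub_le_self _ (Finset.sum_nonneg fun i _ =>
    mul_nonneg (inv_nonneg.2 (E.val_nonneg i)) (sq_nonneg _))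

/-- Variance bound: each retained `λ_i⁻¹` is at most `m`, and Bessel sums the squared coefficients
of the cross mean. -/
theorem mul_sum_fit_sq_le (hm : 0 < m) (y : ℤ → ℝ) :
    (n : ℝ)⁻¹ * ∑ k ∈ Finset.Icc (1 : ℤ) n, E.fit m y k ^ 2
      ≤ m * ‖(n : ℝ)⁻¹ • ∑ k ∈ Finset.Icc (1 : ℤ) n, y k • x k‖ ^ 2 := by
  have h := mul_sum_lsFit_sq (E.val_ne_zero_of_mem hm) (E.scores_orthogonal hm) y
  unfold fit
  rw [h]
  have hb : ∀ i, (n : ℝ)⁻¹ * ∑ j ∈ Finset.Icc (1 : ℤ) n, y j * inner ℝ (E.vec i) (x j)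
      = inner ℝ (E.vec i) ((n : ℝ)⁻¹ • ∑ k ∈ Finset.Icc (1 : ℤ) n, y k • x k) := fun i => by
    rw [real_inner_smul_right, inner_sum]
    simp_rw [real_inner_smul_right]
  simp_rw [hb]
  refine le_trans ?_ (mul_le_mul_of_nonneg_left
    (E.sum_inner_vec_sq_le _ (E.val_ne_zero_of_mem hm) _) hm.le)
  rw [Finset.mul_sum]
  gcongr with i hi
  have h1 := E.inv_le_val_of_lt_truncation hm (Finset.mem_range.1 hi)
  exact inv_le_of_inv_le₀ hm h1

/-- Bias bound: for a linear response the projection removes exactly the retained part of `∑ λ_i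
⟨v_i, z⟩²`, and the remaining eigenvalues are below `1 / m`. -/
theorem mul_sum_inner_sub_fit_sq_le (hm : 0 < m) (z : H) :
    (n : ℝ)⁻¹ * ∑ k ∈ Finset.Icc (1 : ℤ) n,
        (inner ℝ z (x k) - E.fit m (fun j => inner ℝ z (x j)) k) ^ 2
      ≤ m⁻¹ * ‖z‖ ^ 2 := by
  have h := mul_sum_sub_lsFit_sq (E.val_ne_zero_of_mem hm) (E.scores_orthogonal hm)
    (fun j => inner ℝ z (x j))
  unfold fit
  rw [h]
  set T := truncation E m
  have hterm : ∀ i ∈ Finset.range T, (E.val i)⁻¹ * ((n : ℝ)⁻¹ * ∑ j ∈ Finset.Icc (1 : ℤ) n,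
      inner ℝ z (x j) * inner ℝ (E.vec i) (x j)) ^ 2 = E.val i * inner ℝ (E.vec i) z ^ 2 :=
    fun i hi => by
      have hi' := E.val_ne_zero_of_mem hm i hi
      rw [E.mul_sum_inner_vec_mul z hi']
      field_simp
  rw [Finset.sum_congr rfl hterm]
  have htot : HasSum (fun i => E.val i * inner ℝ (E.vec i) z ^ 2)
      ((n : ℝ)⁻¹ * ∑ k ∈ Finset.Icc (1 : ℤ) n, inner ℝ z (x k) ^ 2) := by
    have h1 := (E.hasSum z).mapL (innerSL ℝ z)
    have h2 : ∀ i, innerSL ℝ z (E.val i • tensorOp (E.vec i) (E.vec i) z)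
        = E.val i * inner ℝ (E.vec i) z ^ 2 := fun i => by
      simp only [tensorOp, ContinuousLinearMap.smulRight_apply, innerSL_apply_apply,
        real_inner_smul_right, real_inner_comm (E.vec i)]
      ring
    rw [innerSL_apply_apply, real_inner_comm, inner_empCov] at h1
    simp_rw [sq (inner ℝ z (x _))]
    rwa [← funext h2]
  rw [sub_le_iff_le_add]
  -- Every finite partial sum splits into retained indices, enlarged to all of `range T`, and
  -- discarded ones, handled by Bessel.
  refine hasSum_le_of_sum_le htot fun s => ?_
  rw [← Finset.sum_filter_add_sum_filter_not s (· ∈ Finset.range T), add_comm]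
  refine add_le_add ?_ ?_
  -- Vectors with eigenvalue zero need not be orthonormal, so their vanishing terms are dropped
  -- before Bessel is applied.
  · rw [← Finset.sum_filter_add_sum_filter_not _ (fun i => E.val i ≠ 0), add_comm,
      Finset.sum_eq_zero fun i hi => ?_, zero_add]
    · refine le_trans ?_ (mul_le_mul_of_nonneg_left
        (E.sum_inner_vec_sq_le
          ((s.filter (· ∉ Finset.range T)).filter fun i => E.val i ≠ 0)
          (fun i hi => (Finset.mem_filter.1 hi).2) z) (inv_nonneg.2 hm.le))
      rw [Finset.mul_sum]
      refine Finset.sum_le_sum fun i hi => ?_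
      have hi' := (Finset.mem_filter.1 (Finset.mem_filter.1 hi).1).2
      rw [Finset.mem_range, not_lt] at hi'
      gcongr
      exact (E.val_lt_inv_of_truncation_le hm hi').le
    · have := (Finset.mem_filter.1 hi).2
      rw [not_not] at this
      rw [this, zero_mul]
  · exact Finset.sum_le_sum_of_subset_of_nonneg (fun i hi => (Finset.mem_filter.1 hi).2)
      fun i _ _ => mul_nonneg (E.val_nonneg i) (sq_nonneg _)

/-- The bridge from the operator estimator to scalar regression at a fixed `t`. -/
theorem fpcaEstimator_apply (y : ℤ → C(unitInterval, ℝ)) (k : ℤ) (t : unitInterval) :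
    fpcaEstimator y x n E m (x k) t = E.fit m (fun j => y j t) k := by
  simp only [fpcaEstimator, fit, lsFit, empCov, tensorOp, sum_apply,
    smul_apply, ContinuousLinearMap.comp_apply,
    ContinuousLinearMap.smulRight_apply, innerSL_apply_apply, map_smul, ContinuousMap.sum_apply,
    ContinuousMap.smul_apply, smul_eq_mul]
  refine Finset.sum_congr rfl fun i _ => ?_
  simp_rw [fun j => real_inner_comm (x j) (E.vec i), mul_comm (y _ t)]
  ring

end EigenSystem

theorem sum_sub_mean_sq_le {ι : Type*} (K : Finset ι) (d : ι → ℝ) (hK : K.Nonempty) :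
    ∑ k ∈ K, (d k - (K.card : ℝ)⁻¹ * ∑ j ∈ K, d j) ^ 2 ≤ ∑ k ∈ K, d k ^ 2 := by
  set a := (K.card : ℝ)⁻¹ * ∑ j ∈ K, d j
  have hc : (K.card : ℝ) ≠ 0 := by exact_mod_cast hK.card_ne_zero
  have ha : ∑ j ∈ K, d j = K.card * a := by
    rw [← mul_assoc, mul_inv_cancel₀ hc, one_mul]
  have h : ∀ k, (d k - a) ^ 2 = d k ^ 2 - 2 * a * d k + a ^ 2 := fun k => by ring
  simp_rw [h, Finset.sum_add_distrib, Finset.sum_sub_distrib, ← Finset.mul_sum, ha,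
    Finset.sum_const, nsmul_eq_mul]
  nlinarith [mul_nonneg (Nat.cast_nonneg (α := ℝ) K.card) (sq_nonneg a)]

theorem incrementVar_eq (r : H →L[ℝ] C(unitInterval, ℝ)) (y : ℤ → C(unitInterval, ℝ)) (x : ℤ → H)
    (n : ℕ) (t s : unitInterval) :
    incrementVar r y x n t s = (n : ℝ)⁻¹ * ∑ k ∈ Finset.Icc (1 : ℤ) n,
      (residual r y x k t - residual r y x k s - (n : ℝ)⁻¹ * ∑ j ∈ Finset.Icc (1 : ℤ) n,
        (residual r y x j t - residual r y x j s)) ^ 2 := by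
  simp only [incrementVar, residualCov, residualMean, ContinuousMap.sub_apply,
    ContinuousMap.smul_apply, ContinuousMap.sum_apply, smul_eq_mul]
  rw [Finset.sum_sub_distrib, mul_sub]
  generalize (n : ℝ)⁻¹ * ∑ i ∈ Finset.Icc (1 : ℤ) n, residual r y x i t = a
  generalize (n : ℝ)⁻¹ * ∑ i ∈ Finset.Icc (1 : ℤ) n, residual r y x i s = b
  rw [mul_left_comm, ← mul_sub, ← mul_add, Finset.mul_sum, ← Finset.sum_sub_distrib,
    ← Finset.sum_add_distrib]
  congr 1
  refine Finset.sum_congr rfl fun k _ => ?_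
  ring

/-- Since fitting is linear in the response, residual increments are the residuals of regressing the
increments of `y`; projecting and then centring only shrinks them. -/
theorem incrementVar_fpcaEstimator_le {x : ℤ → H} {n : ℕ} (E : EigenSystem (empCov x x n)) {m : ℝ}
    (hm : 0 < m) (hn : 1 ≤ n) (y : ℤ → C(unitInterval, ℝ)) (t s : unitInterval) :
    incrementVar (fpcaEstimator y x n E m) y x n t s
      ≤ (n : ℝ)⁻¹ * ∑ k ∈ Finset.Icc (1 : ℤ) n, (y k t - y k s) ^ 2 := by
  rw [incrementVar_eq]
  refine le_trans ?_ (E.mul_sum_sub_fit_sq_le hm fun k => y k t - y k s)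
  refine mul_le_mul_of_nonneg_left ?_ (by positivity)
  have hres : ∀ k, residual (fpcaEstimator y x n E m) y x k t
      - residual (fpcaEstimator y x n E m) y x k s
      = y k t - y k s - E.fit m (fun k => y k t - y k s) k := fun k => by
    simp only [residual, ContinuousMap.sub_apply, E.fpcaEstimator_apply]
    rw [E.fit_sub]
    ring
  simp_rw [hres]
  have h := sum_sub_mean_sq_le (Finset.Icc (1 : ℤ) n)
    (fun k => y k t - y k s - E.fit m (fun k => y k t - y k s) k)
    (Finset.nonempty_Icc.2 (by exact_mod_cast hn))
  simpa using h

theorem abs_errorKernel_le (r ρ : H →L[ℝ] C(unitInterval, ℝ)) (x : ℤ → H) (n : ℕ) {B : ℝ}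
    (hB : ∀ t, (n : ℝ)⁻¹ * ∑ k ∈ Finset.Icc (1 : ℤ) n, (r - ρ) (x k) t ^ 2 ≤ B)
    (t s : unitInterval) : |errorKernel r ρ x n t s| ≤ B := by
  rw [errorKernel, abs_mul, abs_of_nonneg (by positivity : (0 : ℝ) ≤ (n : ℝ)⁻¹)]
  have h : ∑ k ∈ Finset.Icc (1 : ℤ) n, |(r - ρ) (x k) t * (r - ρ) (x k) s|
      ≤ ∑ k ∈ Finset.Icc (1 : ℤ) n, ((r - ρ) (x k) t ^ 2 + (r - ρ) (x k) s ^ 2) / 2 := by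
    refine Finset.sum_le_sum fun k _ => ?_
    rw [abs_mul]
    nlinarith [sq_nonneg (|(r - ρ) (x k) t| - |(r - ρ) (x k) s|), sq_abs ((r - ρ) (x k) t),
      sq_abs ((r - ρ) (x k) s)]
  have h2 := mul_le_mul_of_nonneg_left ((Finset.abs_sum_le_sum_abs _ _).trans h)
    (by positivity : (0 : ℝ) ≤ (n : ℝ)⁻¹)
  refine h2.trans ?_
  rw [← Finset.sum_div, Finset.sum_add_distrib]
  have h3 := hB t
  have h4 := hB s
  linarith

theorem abs_errorKernel_fpcaEstimator_le [CompleteSpace H] {x : ℤ → H} {n : ℕ}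
    (E : EigenSystem (empCov x x n)) {m : ℝ} (hm : 0 < m) (ρ : H →L[ℝ] C(unitInterval, ℝ))
    (y e : ℤ → C(unitInterval, ℝ)) (hy : ∀ k, y k = ρ (x k) + e k) {B : ℝ}
    (hB : ∀ t, ‖(n : ℝ)⁻¹ • ∑ k ∈ Finset.Icc (1 : ℤ) n, e k t • x k‖ ^ 2 ≤ B)
    (t s : unitInterval) :
    |errorKernel (fpcaEstimator y x n E m) ρ x n t s| ≤ 2 * (m⁻¹ * ‖ρ‖ ^ 2 + m * B) := by
  refine abs_errorKernel_le _ _ _ _ (fun t => ?_) t s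
  let φ : H →L[ℝ] ℝ := (ContinuousMap.evalCLM ℝ t).comp ρ
  let z : H := (InnerProductSpace.toDual ℝ H).symm φ
  have hz : ∀ w, inner ℝ z w = ρ w t := fun w => by
    simp [z, φ]
  have hzn : ‖z‖ ≤ ‖ρ‖ := by
    rw [LinearIsometryEquiv.norm_map]
    refine ContinuousLinearMap.opNorm_le_bound _ ρ.opNorm_nonneg fun w => ?_
    exact ((ρ w).norm_coe_le_norm t).trans (ρ.le_opNorm w)
  -- Fitted noise minus the bias, with `z` the Riesz representer of `w ↦ ρ w t`.
  have hdec : ∀ k, (fpcaEstimator y x n E m - ρ) (x k) t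
      = E.fit m (fun j => e j t) k
        - (inner ℝ z (x k) - E.fit m (fun j => inner ℝ z (x j)) k) := fun k => by
    rw [sub_apply, ContinuousMap.sub_apply, E.fpcaEstimator_apply]
    simp_rw [hy, ContinuousMap.add_apply, hz]
    rw [E.fit_add]
    ring
  simp_rw [hdec]
  have h1 := E.mul_sum_fit_sq_le hm fun j => e j t
  have h2 := E.mul_sum_inner_sub_fit_sq_le hm z
  have h3 : m⁻¹ * ‖z‖ ^ 2 ≤ m⁻¹ * ‖ρ‖ ^ 2 := by gcongr
  have h4 := mul_le_mul_of_nonneg_left (hB t) hm.le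
  have h5 : ∀ a b : ℝ, (a - b) ^ 2 ≤ 2 * a ^ 2 + 2 * b ^ 2 := fun a b => by
    nlinarith [sq_nonneg (a + b)]
  have h6 := mul_le_mul_of_nonneg_left (Finset.sum_le_sum fun k (_ : k ∈ Finset.Icc (1 : ℤ) n) =>
    h5 (E.fit m (fun j => e j t) k) (inner ℝ z (x k) - E.fit m (fun j => inner ℝ z (x j)) k))
    (by positivity : (0 : ℝ) ≤ (n : ℝ)⁻¹)
  rw [Finset.sum_add_distrib, ← Finset.mul_sum, ← Finset.mul_sum] at h6
  linarith

end Estimator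

/-! ### A maximal inequality for stationary sequences -/

section Maximal

/-- `max_{0 ≤ n ≤ N} ∑_{k=1}^n (w k - c)`. -/
def maxPartialSum (c : ℝ) : ℕ → (ℤ → ℝ) → ℝ
  | 0, _ => 0
  | N + 1, w => max 0 (w 1 - c + maxPartialSum c N fun k => w (k + 1))

variable {c : ℝ}

theorem maxPartialSum_nonneg (N : ℕ) (w : ℤ → ℝ) : 0 ≤ maxPartialSum c N w := by
  cases N with
  | zero => exact le_rfl
  | succ N => exact le_max_left _ _

theorem maxPartialSum_le_succ (N : ℕ) (w : ℤ → ℝ) :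
    maxPartialSum c N w ≤ maxPartialSum c (N + 1) w := by
  induction N generalizing w with
  | zero => exact maxPartialSum_nonneg 1 w
  | succ N ih => exact max_le_max le_rfl (add_le_add le_rfl (ih _))

theorem maxPartialSum_mono (w : ℤ → ℝ) : Monotone fun N => maxPartialSum c N w :=
  monotone_nat_of_le_succ fun N => maxPartialSum_le_succ N w

theorem measurable_maxPartialSum (N : ℕ) : Measurable (maxPartialSum c N) := by
  induction N with
  | zero => exact measurable_const
  | succ N ih =>
    have h : Measurable fun (w : ℤ → ℝ) k => w (k + 1) :=
      measurable_pi_lambda _ fun k => measurable_pi_apply (k + 1)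
    exact measurable_const.max (((measurable_pi_apply 1).sub_const c).fun_add (ih.comp h))

theorem Icc_one_succ (n : ℕ) :
    Finset.Icc (1 : ℤ) (n + 1 : ℕ)
      = insert 1 ((Finset.Icc (1 : ℤ) n).map ⟨fun k => k + 1, add_left_injective 1⟩) := by
  ext k
  simp only [Finset.mem_Icc, Finset.mem_insert, Finset.mem_map, Function.Embedding.coeFn_mk]
  constructor
  · intro h
    by_cases h1 : k = 1
    · exact Or.inl h1
    · exact Or.inr ⟨k - 1, by push_cast at h; omega, by ring⟩
  · push_cast
    rintro (rfl | ⟨j, hj, hk⟩)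
    · exact ⟨le_rfl, by omega⟩
    · change j + 1 = k at hk
      omega

theorem sum_Icc_one_succ (n : ℕ) (w : ℤ → ℝ) :
    ∑ k ∈ Finset.Icc (1 : ℤ) (n + 1 : ℕ), w k
      = w 1 + ∑ k ∈ Finset.Icc (1 : ℤ) n, w (k + 1) := by
  rw [Icc_one_succ, Finset.sum_insert, Finset.sum_map]
  · rfl
  · simp only [Finset.mem_map, Finset.mem_Icc, Function.Embedding.coeFn_mk]
    rintro ⟨j, hj, h⟩
    omega

theorem sum_sub_le_maxPartialSum (n : ℕ) (w : ℤ → ℝ) :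
    ∑ k ∈ Finset.Icc (1 : ℤ) n, (w k - c) ≤ maxPartialSum c n w := by
  induction n generalizing w with
  | zero => simp [maxPartialSum]
  | succ n ih =>
    rw [sum_Icc_one_succ n fun k => w k - c]
    exact (add_le_add le_rfl (ih _)).trans (le_max_right _ _)

variable {Ω : Type*} [MeasurableSpace Ω] {P : Measure Ω} [IsProbabilityMeasure P]

theorem integrable_maxPartialSum (N : ℕ) {W : ℤ → Ω → ℝ} (hW : ∀ k, Integrable (W k) P) :
    Integrable (fun ω => maxPartialSum c N fun k => W k ω) P := by
  induction N generalizing W with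
  | zero => exact integrable_zero _ _ _
  | succ N ih =>
    exact (integrable_zero _ _ _).sup
      (((hW 1).sub (integrable_const c)).add (ih fun k => hW (k + 1)))

/-- The average of `w 1, …, w n`. -/
def average (w : ℤ → ℝ) (n : ℕ) : ℝ := (n : ℝ)⁻¹ * ∑ k ∈ Finset.Icc (1 : ℤ) n, w k

theorem maxPartialSum_pos_of_lt_average {w : ℤ → ℝ} {n : ℕ} (hc : 0 ≤ c) (h : c < average w n) :
    0 < maxPartialSum c n w := by
  rcases Nat.eq_zero_or_pos n with rfl | hn
  · simp [average] at h
    exact absurd h hc.not_gt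
  refine lt_of_lt_of_le ?_ (sum_sub_le_maxPartialSum n w)
  rw [average, lt_inv_mul_iff₀ (by exact_mod_cast hn)] at h
  simp
  linarith

/-- Garsia's proof of the maximal ergodic inequality: stationarity gives the maximum and its shift
the same mean, so their difference integrates to zero. -/
theorem measure_maxPartialSum_pos_le {W : ℤ → Ω → ℝ} (hW : ∀ k, Integrable (W k) P)
    (hmeas : ∀ k, Measurable (W k)) (hnn : ∀ k ω, 0 ≤ W k ω)
    (hstat : IdentDistrib (fun ω (k : ℤ) => W (k + 1) ω) (fun ω (k : ℤ) => W k ω) P P)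
    (N : ℕ) :
    c * P.real {ω | 0 < maxPartialSum c N fun k => W k ω} ≤ ∫ ω, W 1 ω ∂P := by
  set A := {ω | 0 < maxPartialSum c N fun k => W k ω}
  have hmW : Measurable fun ω (k : ℤ) => W k ω := measurable_pi_lambda _ hmeas
  have hA : MeasurableSet A :=
    measurableSet_lt measurable_const ((measurable_maxPartialSum N).comp hmW)
  have hI1 := integrable_maxPartialSum (c := c) N hW
  have hI2 := integrable_maxPartialSum (c := c) N fun k => hW (k + 1)
  have heq : ∫ ω, maxPartialSum c N (fun k => W (k + 1) ω) ∂P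
      = ∫ ω, maxPartialSum c N (fun k => W k ω) ∂P :=
    (hstat.comp (measurable_maxPartialSum (c := c) N)).integral_eq
  -- Where the maximum is positive, the recursion attains it in the second branch; elsewhere it is
  -- zero and its shift is nonnegative.
  have hpt : ∀ ω, maxPartialSum c N (fun k => W k ω) - maxPartialSum c N (fun k => W (k + 1) ω)
      ≤ A.indicator (fun ω => W 1 ω - c) ω := fun ω => by
    by_cases hω : ω ∈ A
    · rw [Set.indicator_of_mem hω]
      have hpos : 0 < maxPartialSum c N fun k => W k ω := hω
      cases N with
      | zero => exact absurd hpos (lt_irrefl _)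
      | succ N =>
        have h1 : maxPartialSum c (N + 1) (fun k => W k ω)
            = W 1 ω - c + maxPartialSum c N fun k => W (k + 1) ω :=
          max_eq_right_of_lt ((lt_max_iff.1 hpos).resolve_left (lt_irrefl _))
        have h2 := maxPartialSum_le_succ (c := c) N fun k => W (k + 1) ω
        linarith
    · rw [Set.indicator_of_notMem hω]
      have h1 : maxPartialSum c N (fun k => W k ω) ≤ 0 := not_lt.1 hω
      have h2 := maxPartialSum_nonneg (c := c) N fun k => W (k + 1) ω
      linarith
  have h := integral_mono (hI1.sub hI2) (((hW 1).sub (integrable_const c)).indicator hA) hpt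
  rw [integral_sub' hI1 hI2, heq, sub_self, integral_indicator hA,
    integral_sub' (hW 1).integrableOn (integrable_const c).integrableOn, setIntegral_const,
    smul_eq_mul] at h
  have h2 := setIntegral_le_integral (s := A) (hW 1) (Eventually.of_forall (hnn 1))
  linarith

theorem measure_exists_lt_average_le {W : ℤ → Ω → ℝ} (hW : ∀ k, Integrable (W k) P)
    (hmeas : ∀ k, Measurable (W k)) (hnn : ∀ k ω, 0 ≤ W k ω)
    (hstat : IdentDistrib (fun ω (k : ℤ) => W (k + 1) ω) (fun ω (k : ℤ) => W k ω) P P)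
    (hc : 0 < c) :
    P {ω | ∃ n, c < average (fun k => W k ω) n} ≤ ENNReal.ofReal ((∫ ω, W 1 ω ∂P) / c) := by
  have hsub : {ω | ∃ n, c < average (fun k => W k ω) n}
      ⊆ ⋃ N, {ω | 0 < maxPartialSum c N fun k => W k ω} := by
    rintro ω ⟨n, hn⟩
    exact Set.mem_iUnion.2 ⟨n, maxPartialSum_pos_of_lt_average hc.le hn⟩
  have hmono : Monotone fun N => {ω | 0 < maxPartialSum c N fun k => W k ω} :=
    fun N N' h ω hω => lt_of_lt_of_le hω (maxPartialSum_mono _ h)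
  refine (measure_mono hsub).trans ?_
  rw [hmono.measure_iUnion]
  refine iSup_le fun N => ?_
  rw [← ofReal_measureReal]
  refine ENNReal.ofReal_le_ofReal ?_
  rw [le_div_iff₀ hc, mul_comm]
  exact measure_maxPartialSum_pos_le hW hmeas hnn hstat N

/-- The averages of a nonnegative integrable stationary sequence are dominated by the square of an
integrable variable. -/
theorem exists_integrable_average_lt_sq {W : ℤ → Ω → ℝ} (hW : ∀ k, Integrable (W k) P)
    (hmeas : ∀ k, Measurable (W k)) (hnn : ∀ k ω, 0 ≤ W k ω)
    (hstat : IdentDistrib (fun ω (k : ℤ) => W (k + 1) ω) (fun ω (k : ℤ) => W k ω) P P) :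
    ∃ M : Ω → ℝ, Measurable M ∧ (∀ ω, 0 < M ω) ∧ Integrable M P ∧
      ∀ᵐ ω ∂P, ∀ n, average (fun k => W k ω) n < M ω ^ 2 := by
  set A : ℕ → Ω → ℝ := fun n ω => average (fun k => W k ω) n
  set K := ∫ ω, W 1 ω ∂P
  have hK : 0 ≤ K := integral_nonneg (hnn 1)
  have hA : ∀ n, Measurable (A n) := fun n =>
    (Finset.measurable_fun_sum _ fun k _ => hmeas k).const_mul _
  set s : Ω → ℝ := fun ω => ⨆ n, A n ω
  have hs : Measurable s := .iSup hA
  have hsqrt : Measurable fun ω => √(s ω) := hs.sqrt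
  have hbdd : ∀ᵐ ω ∂P, BddAbove (Set.range fun n => A n ω) := by
    -- Unbounded averages exceed every level, so the maximal inequality makes this event null.
    have hle : ∀ N : ℕ, P {ω | ¬ BddAbove (Set.range fun n => A n ω)}
        ≤ ENNReal.ofReal (K / (N + 1 : ℕ)) := fun N => by
      refine (measure_mono fun ω hω => ?_).trans
        (measure_exists_lt_average_le hW hmeas hnn hstat (by positivity))
      rw [Set.mem_ofPred_eq, not_bddAbove_iff] at hω
      obtain ⟨_, ⟨n, rfl⟩, hn⟩ := hω (N + 1 : ℕ)
      exact ⟨n, hn⟩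
    have hlim : Tendsto (fun N : ℕ => ENNReal.ofReal (K / (N + 1 : ℕ))) atTop (𝓝 0) := by
      have := ENNReal.tendsto_ofReal
        ((tendsto_const_div_atTop_nhds_zero_nat K).comp (tendsto_add_atTop_nat 1))
      simpa using this
    exact le_antisymm (ge_of_tendsto' hlim hle) bot_le
  -- Layer cake, split at `1`: probabilities are at most `1` below, and the maximal inequality at
  -- level `t²` gives the tail `K t⁻²` above.
  have hint : Integrable (fun ω => √(s ω)) P := by
    refine ⟨hsqrt.aestronglyMeasurable, ?_⟩
    rw [hasFiniteIntegral_iff_ofReal (Eventually.of_forall fun ω => Real.sqrt_nonneg _),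
      lintegral_eq_lintegral_meas_lt P (Eventually.of_forall fun ω => Real.sqrt_nonneg _)
        hsqrt.aemeasurable,
      ← Set.Ioc_union_Ioi_eq_Ioi zero_le_one]
    refine (lintegral_union_le _ _ _).trans_lt (ENNReal.add_lt_top.2 ⟨?_, ?_⟩)
    · refine (setLIntegral_mono measurable_const fun t _ => prob_le_one).trans_lt ?_
      simp
    · have htail : ∀ t ∈ Set.Ioi (1 : ℝ), P {ω | t < √(s ω)}
          ≤ ENNReal.ofReal (K * t ^ (-2 : ℝ)) := fun t ht => by
        have ht0 : (0 : ℝ) < t := zero_lt_one.trans ht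
        refine (measure_mono fun ω hω => ?_).trans
          ((measure_exists_lt_average_le hW hmeas hnn hstat (pow_pos ht0 2)).trans_eq ?_)
        · exact exists_lt_of_lt_ciSup ((Real.lt_sqrt ht0.le).1 hω)
        · rw [Real.rpow_neg ht0.le, Real.rpow_two, div_eq_mul_inv]
      have hi : IntegrableOn (fun t : ℝ => K * t ^ (-2 : ℝ)) (Set.Ioi 1) :=
        (integrableOn_Ioi_rpow_of_lt (by norm_num) zero_lt_one).const_mul K
      exact (setLIntegral_mono' measurableSet_Ioi htail).trans_lt hi.lintegral_lt_top
  -- Adding `1` makes the variable positive and the final bound strict.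
  refine ⟨fun ω => √(s ω) + 1, hsqrt.add_const 1, fun ω => by positivity,
    hint.add (integrable_const 1), ?_⟩
  filter_upwards [hbdd] with ω hω n
  have h1 : A n ω ≤ s ω := le_ciSup hω n
  have h2 : s ω ≤ √(s ω) ^ 2 := by
    rcases le_total 0 (s ω) with h | h
    · rw [Real.sq_sqrt h]
    · exact h.trans (sq_nonneg _)
  have h3 := Real.sqrt_nonneg (s ω)
  change A n ω < _
  nlinarith

end Maximal

/-! ### Hölder constants -/

section HolderConst

/-- The Hölder seminorm of order `α` on `C[0,1]`. -/
def holderSeminorm (α : ℝ) (f : C(unitInterval, ℝ)) : ENNReal :=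
  ⨆ (t : unitInterval) (s : unitInterval),
    ENNReal.ofReal (|f t - f s| / |(t : ℝ) - s| ^ α)

/-- The supremum is uncountable, but one of continuous functions is lower semicontinuous, hence
Borel. -/
theorem measurable_holderSeminorm (α : ℝ) : Measurable (holderSeminorm α) := by
  refine LowerSemicontinuous.measurable (lowerSemicontinuous_iSup fun t =>
    lowerSemicontinuous_iSup fun s => Continuous.lowerSemicontinuous ?_)
  refine ENNReal.continuous_ofReal.comp (Continuous.div_const ?_ _)
  exact ((continuous_eval_const t).sub
    (continuous_eval_const s)).abs

/-- The Hölder constant of order `α`, as a real number. -/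
def holderConst (α : ℝ) (f : C(unitInterval, ℝ)) : ℝ := (holderSeminorm α f).toReal

theorem measurable_holderConst (α : ℝ) : Measurable (holderConst α) :=
  (measurable_holderSeminorm α).ennreal_toReal

theorem holderConst_nonneg (α : ℝ) (f : C(unitInterval, ℝ)) : 0 ≤ holderConst α f :=
  ENNReal.toReal_nonneg

variable {α : ℝ} {f : C(unitInterval, ℝ)} {c : ℝ}

theorem holderSeminorm_le (hc : 0 ≤ c)
    (h : ∀ t s : unitInterval, t ≠ s → |f t - f s| ≤ c * |(t : ℝ) - s| ^ α) :
    holderSeminorm α f ≤ ENNReal.ofReal c := by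
  refine iSup_le fun t => iSup_le fun s => ENNReal.ofReal_le_ofReal ?_
  rcases eq_or_ne t s with rfl | hts
  · simpa using hc
  · have hpos : 0 < |(t : ℝ) - s| ^ α :=
      Real.rpow_pos_of_pos (abs_pos.2 (sub_ne_zero.2 fun h => hts (Subtype.ext h))) _
    rw [div_le_iff₀ hpos]
    exact h t s hts

theorem holderConst_le (hc : 0 ≤ c)
    (h : ∀ t s : unitInterval, t ≠ s → |f t - f s| ≤ c * |(t : ℝ) - s| ^ α) :
    holderConst α f ≤ c :=
  ENNReal.toReal_le_of_le_ofReal hc (holderSeminorm_le hc h)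

/-- The constant `c` serves only to make the seminorm finite, since `toReal` sends `⊤` to `0`. -/
theorem abs_sub_le_holderConst (hc : 0 ≤ c)
    (h : ∀ t s : unitInterval, t ≠ s → |f t - f s| ≤ c * |(t : ℝ) - s| ^ α)
    (t s : unitInterval) : |f t - f s| ≤ holderConst α f * |(t : ℝ) - s| ^ α := by
  rcases eq_or_ne t s with rfl | hts
  · rw [sub_self, abs_zero]
    exact mul_nonneg (holderConst_nonneg α f) (Real.rpow_nonneg (abs_nonneg _) _)
  · have hpos : 0 < |(t : ℝ) - s| ^ α :=
      Real.rpow_pos_of_pos (abs_pos.2 (sub_ne_zero.2 fun h => hts (Subtype.ext h))) _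
    rw [← div_le_iff₀ hpos]
    have hfin := ((holderSeminorm_le hc h).trans_lt ENNReal.ofReal_lt_top).ne
    exact (ENNReal.ofReal_le_iff_le_toReal hfin).1
      (le_iSup₂ (f := fun t s : unitInterval =>
        ENNReal.ofReal (|f t - f s| / |(t : ℝ) - s| ^ α)) t s)

end HolderConst

/-! ### Second moments of orthogonal sums -/

section SecondMoment

variable {Ω H : Type*} [MeasurableSpace Ω] {P : Measure Ω} [NormedAddCommGroup H]
  [InnerProductSpace ℝ H]

theorem integrable_inner_of_memLp_two {f g : Ω → H} (hf : MemLp f 2 P) (hg : MemLp g 2 P) :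
    Integrable (fun ω => inner ℝ (f ω) (g ω)) P := by
  refine ((hf.integrable_norm_pow two_ne_zero).add (hg.integrable_norm_pow two_ne_zero)).mono'
    (hf.1.inner hg.1) (Eventually.of_forall fun ω => ?_)
  refine (norm_inner_le_norm _ _).trans ?_
  simp only [Pi.add_apply]
  nlinarith [sq_nonneg (‖f ω‖ - ‖g ω‖), sq_nonneg ‖f ω‖, sq_nonneg ‖g ω‖]

theorem integral_norm_sum_sq_of_orthogonal {ι : Type*} [DecidableEq ι] (K : Finset ι)
    {D : ι → Ω → H} (hD : ∀ k, MemLp (D k) 2 P)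
    (horth : ∀ j k, j ≠ k → ∫ ω, inner ℝ (D j ω) (D k ω) ∂P = 0) :
    ∫ ω, ‖∑ k ∈ K, D k ω‖ ^ 2 ∂P = ∑ k ∈ K, ∫ ω, ‖D k ω‖ ^ 2 ∂P := by
  have hint : ∀ j k, Integrable (fun ω => inner ℝ (D j ω) (D k ω)) P :=
    fun j k => integrable_inner_of_memLp_two (hD j) (hD k)
  simp_rw [← real_inner_self_eq_norm_sq, sum_inner, inner_sum]
  rw [integral_finsetSum _ fun j _ => integrable_finsetSum _ fun k _ => hint j k]
  refine Finset.sum_congr rfl fun j hj => ?_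
  rw [integral_finsetSum _ fun k _ => hint j k, Finset.sum_eq_single j]
  · exact fun k _ hkj => horth j k hkj.symm
  · exact fun h => absurd hj h

theorem memLp_two_smul_of_indepFun [MeasurableSpace H] [BorelSpace H] [SecondCountableTopology H]
    {e : Ω → ℝ} {X : Ω → H}
    (he : Measurable e) (hX : Measurable X) (he2 : Integrable (fun ω => e ω ^ 2) P)
    (hX2 : Integrable (fun ω => ‖X ω‖ ^ 2) P) (hind : IndepFun e X P) :
    MemLp (fun ω => e ω • X ω) 2 P ∧
      ∫ ω, ‖e ω • X ω‖ ^ 2 ∂P = (∫ ω, e ω ^ 2 ∂P) * ∫ ω, ‖X ω‖ ^ 2 ∂P := by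
  have hind2 : IndepFun (fun ω => e ω ^ 2) (fun ω => ‖X ω‖ ^ 2) P :=
    hind.comp (measurable_id.pow_const 2) (measurable_norm.pow_const 2)
  have heq : ∀ ω, ‖e ω • X ω‖ ^ 2 = e ω ^ 2 * ‖X ω‖ ^ 2 := fun ω => by
    rw [norm_smul, mul_pow, Real.norm_eq_abs, sq_abs]
  constructor
  · rw [memLp_two_iff_integrable_sq_norm (he.fun_smul hX).aestronglyMeasurable]
    simp_rw [heq]
    exact hind2.integrable_mul he2 hX2
  · simp_rw [heq]
    exact hind2.integral_mul_eq_mul_integral he2.1 hX2.1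

end SecondMoment

/-- Domination by variables whose means vanish implies convergence to zero in probability. -/
theorem tendstoInMeasure_zero_of_le {Ω : Type*} [MeasurableSpace Ω] {P : Measure Ω}
    [IsProbabilityMeasure P]
    {f g : ℕ → Ω → ℝ} (hf : ∀ n ω, 0 ≤ f n ω) (hg : ∀ n, Integrable (g n) P)
    (hfg : ∀ᶠ n in atTop, ∀ᵐ ω ∂P, f n ω ≤ g n ω)
    (hlim : Tendsto (fun n => ∫ ω, g n ω ∂P) atTop (𝓝 0)) :
    TendstoInMeasure P f atTop fun _ => (0 : ℝ) := by
  rw [tendstoInMeasure_iff_norm]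
  intro a ha
  have hlim' : Tendsto (fun n => ENNReal.ofReal ((∫ ω, g n ω ∂P) / a)) atTop (𝓝 0) := by
    have := ENNReal.tendsto_ofReal (hlim.div_const a)
    simpa using this
  refine tendsto_of_tendsto_of_tendsto_of_le_of_le' tendsto_const_nhds hlim'
    (Eventually.of_forall fun _ => bot_le) ?_
  filter_upwards [hfg] with n hn
  have hg0 : 0 ≤ᵐ[P] g n := by
    filter_upwards [hn] with ω hω using (hf n ω).trans hω
  -- Only monotonicity of the measure is used for `f`, so `f` may be nonmeasurable; Markov is
  -- applied to `g`.
  have h1 : P {ω | a ≤ ‖f n ω - 0‖} ≤ P {ω | a ≤ g n ω} := by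
    refine measure_mono_ae ?_
    filter_upwards [hn] with ω hω h
    have h' : a ≤ ‖f n ω - 0‖ := h
    rw [sub_zero, Real.norm_of_nonneg (hf n ω)] at h'
    exact h'.trans hω
  refine h1.trans ?_
  rw [← ofReal_measureReal]
  refine ENNReal.ofReal_le_ofReal ?_
  rw [le_div_iff₀ ha, mul_comm]
  exact mul_meas_ge_le_integral_of_nonneg hg0 (hg n) a

/-! ### Consequences of the model assumptions -/

section Model

variable {Ω H : Type*} [MeasurableSpace Ω] {P : Measure Ω} [NormedAddCommGroup H]
  [InnerProductSpace ℝ H]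
  [MeasurableSpace H] {ρ : H →L[ℝ] C(unitInterval, ℝ)} {X : ℤ → Ω → H}
  {Y ε : ℤ → Ω → C(unitInterval, ℝ)} {S : Type*} [MeasurableSpace S] {α : ℝ}

theorem LinearModel.identDistrib_X (hmodel : LinearModel P ρ X Y ε) (k : ℤ) :
    IdentDistrib (X k) (X 0) P P := by
  have h := (hmodel.stationary k).comp
    (measurable_snd.comp (measurable_pi_apply (0 : ℤ)) :
      Measurable fun p : ℤ → C(unitInterval, ℝ) × H => (p 0).2)
  simpa [Function.comp_def] using h

theorem HolderSetting.ae_exists_holder_ε (hholder : HolderSetting P ρ X ε α) :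
    ∀ᵐ ω ∂P, ∀ k, ∃ c, 0 ≤ c ∧ ∀ t s : unitInterval, t ≠ s →
      |ε k ω t - ε k ω s| ≤ c * |(t : ℝ) - s| ^ α := by
  obtain ⟨M, hM⟩ := hholder.errors
  rw [ae_all_iff]
  intro k
  filter_upwards [(hM k).2.2.2.2] with ω hω
  exact ⟨M k ω, ((hM k).2.1 ω).le, fun t s hts => (hω t s hts).le⟩

/-- The given `M k` need not be stationary in `k`. The optimal constant is one measurable function
of the path, so it inherits laws and independence from `ε k`, while `M k` dominates it. -/
theorem HolderSetting.integrable_holderConst_ε_sq (hmodel : LinearModel P ρ X Y ε)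
    (hholder : HolderSetting P ρ X ε α) (k : ℤ) :
    Integrable (fun ω => holderConst α (ε k ω) ^ 2) P := by
  obtain ⟨M, hM⟩ := hholder.errors
  refine (hM k).2.2.2.1.mono'
    (((measurable_holderConst α).comp (hmodel.measurable_ε k)).pow_const 2).aestronglyMeasurable ?_
  filter_upwards [(hM k).2.2.2.2] with ω hω
  rw [Real.norm_of_nonneg (sq_nonneg _)]
  have h := holderConst_le ((hM k).2.1 ω).le fun t s hts => (hω t s hts).le
  have h0 := holderConst_nonneg α (ε k ω)
  gcongr

theorem LinearModel.indepFun_ε_X (hmodel : LinearModel P ρ X Y ε) (k : ℤ) :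
    IndepFun (ε k) (X k) P :=
  (hmodel.indep k).comp measurable_id
    ((measurable_pi_apply (⟨k, Set.self_mem_Iic⟩ : Set.Iic k)).comp measurable_fst)

theorem LinearModel.indepFun_ε_past (hmodel : LinearModel P ρ X Y ε) {j k : ℤ} (hjk : j < k) :
    IndepFun (ε k) (fun ω => (ε j ω, X j ω, X k ω)) P :=
  (hmodel.indep k).comp measurable_id
    (((measurable_pi_apply (⟨j, hjk⟩ : Set.Iio k)).comp measurable_snd).prodMk
      (((measurable_pi_apply (⟨j, hjk.le⟩ : Set.Iic k)).comp measurable_fst).prodMk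
        ((measurable_pi_apply (⟨k, Set.self_mem_Iic⟩ : Set.Iic k)).comp measurable_fst)))

theorem HolderSetting.ae_exists_holder_Y (hmodel : LinearModel P ρ X Y ε)
    (hholder : HolderSetting P ρ X ε α) :
    ∀ᵐ ω ∂P, ∀ k, ∃ c, 0 ≤ c ∧ ∀ t s : unitInterval, t ≠ s →
      |Y k ω t - Y k ω s| ≤ c * |(t : ℝ) - s| ^ α := by
  obtain ⟨R, hR⟩ := hholder.operator
  filter_upwards [hholder.ae_exists_holder_ε, ae_all_iff.2 hmodel.model] with ω hω hY k
  obtain ⟨c, hc, h⟩ := hω k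
  refine ⟨|R| * ‖X k ω‖ + c, by positivity, fun t s hts => ?_⟩
  have h1 := hR (X k ω) t s
  have h2 := h t s hts
  have h3 : R * ‖X k ω‖ * |(t : ℝ) - s| ^ α ≤ |R| * ‖X k ω‖ * |(t : ℝ) - s| ^ α := by
    gcongr
    exact le_abs_self R
  rw [hY k, ContinuousMap.add_apply, ContinuousMap.add_apply, add_sub_add_comm, add_mul]
  exact (abs_add_le _ _).trans (add_le_add (h1.trans h3) h2)

variable [IsProbabilityMeasure P]

theorem HilbertSetting.integrable_norm_X_sq (hhilbert : HilbertSetting S P X ε) (k : ℤ) :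
    Integrable (fun ω => ‖X k ω‖ ^ 2) P :=
  ((hhilbert.approximable.1 k).mono_exponent (by norm_num)).integrable_norm_pow two_ne_zero

theorem HilbertSetting.memLp_two_ε (hhilbert : HilbertSetting S P X ε) (k : ℤ) :
    MemLp (ε k) 2 P :=
  (hhilbert.memLp_ε k).mono_exponent (by norm_num)

theorem HilbertSetting.integral_ε_apply (hhilbert : HilbertSetting S P X ε) (k : ℤ)
    (t : unitInterval) : ∫ ω, ε k ω t ∂P = 0 := by
  have h := (ContinuousMap.evalCLM ℝ t).integral_comp_comm
    ((hhilbert.memLp_ε k).integrable (by norm_num))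
  rw [hhilbert.mean_ε k, map_zero] at h
  exact h

theorem measurable_eval (t : unitInterval) : Measurable fun f : C(unitInterval, ℝ) => f t :=
  (continuous_eval_const t).measurable

theorem HilbertSetting.integrable_ε_apply_sq (hmodel : LinearModel P ρ X Y ε)
    (hhilbert : HilbertSetting S P X ε) (k : ℤ) (t : unitInterval) :
    Integrable (fun ω => ε k ω t ^ 2) P := by
  refine ((hhilbert.memLp_two_ε k).integrable_norm_pow two_ne_zero).mono'
    (((measurable_eval t).comp (hmodel.measurable_ε k)).pow_const 2).aestronglyMeasurable
    (Eventually.of_forall fun ω => ?_)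
  rw [norm_pow]
  gcongr
  exact (ε k ω).norm_coe_le_norm t

theorem HilbertSetting.integral_ε_apply_sq_le (hmodel : LinearModel P ρ X Y ε)
    (hhilbert : HilbertSetting S P X ε) (k : ℤ) (t : unitInterval) :
    ∫ ω, ε k ω t ^ 2 ∂P ≤ ∫ ω, ‖ε 0 ω‖ ^ 2 ∂P := by
  have h := ((hhilbert.identDistrib_ε k).comp (measurable_norm.pow_const 2)).integral_eq
  simp only [Function.comp_def] at h
  rw [← h]
  refine integral_mono (hhilbert.integrable_ε_apply_sq hmodel k t)
    ((hhilbert.memLp_two_ε k).integrable_norm_pow two_ne_zero) fun ω => ?_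
  rw [← Real.norm_of_nonneg (sq_nonneg (ε k ω t)), norm_pow]
  gcongr
  exact (ε k ω).norm_coe_le_norm t

theorem HolderSetting.integrable_holderConst_Y_sq (hmodel : LinearModel P ρ X Y ε)
    (hhilbert : HilbertSetting S P X ε) (hholder : HolderSetting P ρ X ε α) (k : ℤ) :
    Integrable (fun ω => holderConst α (Y k ω) ^ 2) P := by
  obtain ⟨R, hR⟩ := hholder.operator
  refine ((((hhilbert.integrable_norm_X_sq k).const_mul (R ^ 2)).add
    (hholder.integrable_holderConst_ε_sq hmodel k)).const_mul 2).mono'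
    (((measurable_holderConst α).comp (hmodel.measurable_Y k)).pow_const 2).aestronglyMeasurable ?_
  filter_upwards [hholder.ae_exists_holder_ε, hmodel.model k] with ω hω hY
  obtain ⟨c, hc, h⟩ := hω k
  have h0 := holderConst_nonneg α (ε k ω)
  have hle : holderConst α (Y k ω) ≤ |R| * ‖X k ω‖ + holderConst α (ε k ω) := by
    refine holderConst_le (by positivity) fun t s hts => ?_
    have h1 := hR (X k ω) t s
    have h2 := abs_sub_le_holderConst hc h t s
    have h3 : R * ‖X k ω‖ * |(t : ℝ) - s| ^ α ≤ |R| * ‖X k ω‖ * |(t : ℝ) - s| ^ α := by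
      gcongr
      exact le_abs_self R
    rw [hY, ContinuousMap.add_apply, ContinuousMap.add_apply, add_sub_add_comm, add_mul]
    exact (abs_add_le _ _).trans (add_le_add (h1.trans h3) h2)
  rw [Real.norm_of_nonneg (sq_nonneg _)]
  have h4 : holderConst α (Y k ω) ^ 2 ≤ (|R| * ‖X k ω‖ + holderConst α (ε k ω)) ^ 2 := by
    have := holderConst_nonneg α (Y k ω)
    gcongr
  refine h4.trans ?_
  simp only [Pi.add_apply]
  rw [← sq_abs R]
  nlinarith [sq_nonneg (|R| * ‖X k ω‖ - holderConst α (ε k ω))]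

theorem HolderSetting.exists_incrementVar_lt (hmodel : LinearModel P ρ X Y ε)
    (hhilbert : HilbertSetting S P X ε) (hholder : HolderSetting P ρ X ε α) {m : ℕ → ℝ}
    (hm : ∀ n, 1 ≤ n → 0 < m n)
    (E : ∀ (n : ℕ) (ω : Ω), EigenSystem (empCov (fun k => X k ω) (fun k => X k ω) n)) :
    ∃ M : Ω → ℝ, Measurable M ∧ (∀ ω, 0 < M ω) ∧ Integrable M P ∧
      ∀ᵐ ω ∂P, ∀ n : ℕ, 1 ≤ n → ∀ t s : unitInterval, t ≠ s →
        incrementVar (fpcaEstimator (fun k => Y k ω) (fun k => X k ω) n (E n ω) (m n))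
          (fun k => Y k ω) (fun k => X k ω) n t s < M ω ^ 2 * |(t : ℝ) - s| ^ (2 * α) := by
  have hshift : Measurable fun (p : ℤ → C(unitInterval, ℝ) × H) (k : ℤ) =>
      holderConst α (p k).1 ^ 2 :=
    measurable_pi_lambda _ fun k => ((measurable_holderConst α).comp
      (measurable_fst.comp (measurable_pi_apply k))).pow_const 2
  -- Applying one measurable map to every coordinate preserves the stationarity of the process.
  obtain ⟨M, hM, hpos, hint, hlt⟩ := exists_integrable_average_lt_sq (P := P)
    (W := fun k ω => holderConst α (Y k ω) ^ 2)
    (fun k => hholder.integrable_holderConst_Y_sq hmodel hhilbert k)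
    (fun k => ((measurable_holderConst α).comp (hmodel.measurable_Y k)).pow_const 2)
    (fun k ω => sq_nonneg _) ((hmodel.stationary 1).comp hshift)
  refine ⟨M, hM, hpos, hint, ?_⟩
  filter_upwards [hlt, hholder.ae_exists_holder_Y hmodel] with ω hω hY n hn t s hts
  have hd : 0 < |(t : ℝ) - s| := abs_pos.2 (sub_ne_zero.2 fun h => hts (Subtype.ext h))
  have hd2 : |(t : ℝ) - s| ^ (2 * α) = (|(t : ℝ) - s| ^ α) ^ 2 := by
    rw [mul_comm, Real.rpow_mul hd.le, Real.rpow_two]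
  rw [hd2]
  refine (incrementVar_fpcaEstimator_le (E n ω) (hm n hn) hn (fun k => Y k ω) t s).trans_lt ?_
  refine lt_of_le_of_lt ?_ (mul_lt_mul_of_pos_right (hω n)
    (pow_pos (Real.rpow_pos_of_pos hd α) 2))
  rw [average, mul_assoc, Finset.sum_mul]
  gcongr with k hk
  obtain ⟨c, hc, h⟩ := hY k
  rw [← mul_pow, ← sq_abs]
  gcongr
  exact abs_sub_le_holderConst hc h t s

end Model

/-! ### Uniform bound in `t` for the empirical cross covariance of errors and covariates -/

section CrossMean

variable {H : Type*} [NormedAddCommGroup H] [InnerProductSpace ℝ H]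

/-- The grid point `min (i / N) 1`. -/
def gridPoint (N i : ℕ) : unitInterval := Set.projIcc (0 : ℝ) 1 zero_le_one ((i : ℝ) / N)

theorem exists_abs_sub_gridPoint_le {N : ℕ} (hN : 1 ≤ N) (t : unitInterval) :
    ∃ i ∈ Finset.range (N + 1), |(t : ℝ) - gridPoint N i| ≤ (N : ℝ)⁻¹ := by
  have hN0 : (0 : ℝ) < N := by exact_mod_cast hN
  have ht0 : 0 ≤ (t : ℝ) * N := mul_nonneg t.2.1 hN0.le
  have hfl : (⌊(t : ℝ) * N⌋₊ : ℝ) ≤ t * N := Nat.floor_le ht0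
  have hlt : (t : ℝ) * N < ⌊(t : ℝ) * N⌋₊ + 1 := Nat.lt_floor_add_one _
  have htN : (t : ℝ) * N ≤ N := mul_le_of_le_one_left hN0.le t.2.2
  refine ⟨⌊(t : ℝ) * N⌋₊, ?_, ?_⟩
  · have : (⌊(t : ℝ) * N⌋₊ : ℝ) ≤ N := hfl.trans htN
    rw [Finset.mem_range]
    exact Nat.lt_succ_of_le (by exact_mod_cast this)
  · have hmem : (⌊(t : ℝ) * N⌋₊ : ℝ) / N ∈ Set.Icc (0 : ℝ) 1 :=
      ⟨by positivity, (div_le_one hN0).2 (hfl.trans htN)⟩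
    rw [gridPoint, Set.projIcc_of_mem _ hmem]
    have h1 : (⌊(t : ℝ) * N⌋₊ : ℝ) / N ≤ t := (div_le_iff₀ hN0).2 hfl
    have h2 : (t : ℝ) - (⌊(t : ℝ) * N⌋₊ : ℝ) / N ≤ (N : ℝ)⁻¹ := by
      rw [sub_le_iff_le_add, ← one_div, ← add_div, le_div_iff₀ hN0]
      linarith
    rw [abs_of_nonneg (sub_nonneg.2 h1)]
    exact h2

/-- The supremum over `[0,1]` of the empirical cross covariance is controlled by a grid of mesh
`1 / N` and the Hölder constants. -/
theorem norm_crossMean_sq_le (e : ℤ → C(unitInterval, ℝ)) (x : ℤ → H) (n : ℕ) {N : ℕ}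
    (hN : 1 ≤ N) {α : ℝ} (hα : 0 ≤ α) {l : ℤ → ℝ} (hl0 : ∀ k, 0 ≤ l k)
    (hl : ∀ k (t s : unitInterval), |e k t - e k s| ≤ l k * |(t : ℝ) - s| ^ α)
    (t : unitInterval) :
    ‖(n : ℝ)⁻¹ • ∑ k ∈ Finset.Icc (1 : ℤ) n, e k t • x k‖ ^ 2
      ≤ 2 * ∑ i ∈ Finset.range (N + 1),
          ‖(n : ℝ)⁻¹ • ∑ k ∈ Finset.Icc (1 : ℤ) n, e k (gridPoint N i) • x k‖ ^ 2
        + 2 * (((N : ℝ)⁻¹ ^ α) ^ 2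
          * ((n : ℝ)⁻¹ * ∑ k ∈ Finset.Icc (1 : ℤ) n, l k ^ 2 * ‖x k‖ ^ 2)) := by
  obtain ⟨i, hi, hti⟩ := exists_abs_sub_gridPoint_le hN t
  set s := gridPoint N i
  set a := (n : ℝ)⁻¹ • ∑ k ∈ Finset.Icc (1 : ℤ) n, e k s • x k
  set d := (N : ℝ)⁻¹ ^ α
  have hd : 0 ≤ d := by positivity
  have hdiff : ‖(n : ℝ)⁻¹ • ∑ k ∈ Finset.Icc (1 : ℤ) n, e k t • x k - a‖
      ≤ d * ((n : ℝ)⁻¹ * ∑ k ∈ Finset.Icc (1 : ℤ) n, l k * ‖x k‖) := by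
    rw [← smul_sub, ← Finset.sum_sub_distrib, norm_smul,
      Real.norm_of_nonneg (by positivity : (0 : ℝ) ≤ (n : ℝ)⁻¹), mul_left_comm]
    refine mul_le_mul_of_nonneg_left ?_ (by positivity)
    rw [Finset.mul_sum]
    refine (norm_sum_le _ _).trans (Finset.sum_le_sum fun k _ => ?_)
    rw [← sub_smul, norm_smul, Real.norm_eq_abs, ← mul_assoc, mul_comm d]
    refine mul_le_mul_of_nonneg_right ((hl k t s).trans ?_) (norm_nonneg _)
    exact mul_le_mul_of_nonneg_left (Real.rpow_le_rpow (abs_nonneg _) hti hα) (hl0 k)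
  -- Cauchy–Schwarz moves the square inside the average, where the expectation will factor by
  -- independence.
  have hcs : ((n : ℝ)⁻¹ * ∑ k ∈ Finset.Icc (1 : ℤ) n, l k * ‖x k‖) ^ 2
      ≤ (n : ℝ)⁻¹ * ∑ k ∈ Finset.Icc (1 : ℤ) n, l k ^ 2 * ‖x k‖ ^ 2 := by
    rcases Nat.eq_zero_or_pos n with rfl | hn
    · simp
    have h := sq_sum_le_card_mul_sum_sq (s := Finset.Icc (1 : ℤ) n) (f := fun k => l k * ‖x k‖)
    have hn0 : (0 : ℝ) < n := by exact_mod_cast hn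
    rw [Int.card_Icc, add_sub_cancel_right, Int.toNat_natCast] at h
    simp_rw [mul_pow] at h
    rw [mul_pow]
    calc _ ≤ (n : ℝ)⁻¹ ^ 2 * (n * ∑ k ∈ Finset.Icc (1 : ℤ) n, l k ^ 2 * ‖x k‖ ^ 2) := by gcongr
      _ = _ := by field_simp
  have ha : ‖a‖ ^ 2 ≤ ∑ i ∈ Finset.range (N + 1),
      ‖(n : ℝ)⁻¹ • ∑ k ∈ Finset.Icc (1 : ℤ) n, e k (gridPoint N i) • x k‖ ^ 2 :=
    Finset.single_le_sum (f := fun i =>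
      ‖(n : ℝ)⁻¹ • ∑ k ∈ Finset.Icc (1 : ℤ) n, e k (gridPoint N i) • x k‖ ^ 2)
      (fun _ _ => sq_nonneg _) hi
  set v := (n : ℝ)⁻¹ • ∑ k ∈ Finset.Icc (1 : ℤ) n, e k t • x k
  have hv : ‖v‖ ≤ ‖a‖ + ‖v - a‖ := norm_le_norm_add_norm_sub' v a
  have hsq : ‖v - a‖ ^ 2
      ≤ d ^ 2 * ((n : ℝ)⁻¹ * ∑ k ∈ Finset.Icc (1 : ℤ) n, l k ^ 2 * ‖x k‖ ^ 2) := by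
    refine (pow_le_pow_left₀ (norm_nonneg _) hdiff 2).trans ?_
    rw [mul_pow]
    gcongr
  have hv2 : ‖v‖ ^ 2 ≤ 2 * ‖a‖ ^ 2 + 2 * ‖v - a‖ ^ 2 := by
    nlinarith [norm_nonneg v, sq_nonneg (‖a‖ - ‖v - a‖),
      pow_le_pow_left₀ (norm_nonneg v) hv 2]
  linarith

end CrossMean

/-! ### Moments of the cross covariance, choice of the grid, and consistency -/

section Consistency

variable {Ω H : Type*} [MeasurableSpace Ω] {P : Measure Ω}
  [NormedAddCommGroup H] [InnerProductSpace ℝ H] [MeasurableSpace H] [BorelSpace H]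
  {ρ : H →L[ℝ] C(unitInterval, ℝ)} {X : ℤ → Ω → H}
  {Y ε : ℤ → Ω → C(unitInterval, ℝ)} {S : Type*} [MeasurableSpace S] {α : ℝ}

theorem LinearModel.integral_norm_X_sq (hmodel : LinearModel P ρ X Y ε) (k : ℤ) :
    ∫ ω, ‖X k ω‖ ^ 2 ∂P = ∫ ω, ‖X 0 ω‖ ^ 2 ∂P :=
  ((hmodel.identDistrib_X k).comp (measurable_norm.pow_const 2)).integral_eq

variable [IsProbabilityMeasure P]

theorem HolderSetting.integral_holderConst_sq_mul (hmodel : LinearModel P ρ X Y ε)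
    (hhilbert : HilbertSetting S P X ε) (hholder : HolderSetting P ρ X ε α) (k : ℤ) :
    Integrable (fun ω => holderConst α (ε k ω) ^ 2 * ‖X k ω‖ ^ 2) P ∧
      ∫ ω, holderConst α (ε k ω) ^ 2 * ‖X k ω‖ ^ 2 ∂P
        = (∫ ω, holderConst α (ε 0 ω) ^ 2 ∂P) * ∫ ω, ‖X 0 ω‖ ^ 2 ∂P := by
  have hm := (measurable_holderConst α).pow_const 2
  have hind : IndepFun (fun ω => holderConst α (ε k ω) ^ 2) (fun ω => ‖X k ω‖ ^ 2) P :=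
    (hmodel.indepFun_ε_X k).comp hm (measurable_norm.pow_const 2)
  have h1 := hholder.integrable_holderConst_ε_sq hmodel k
  have h2 := hhilbert.integrable_norm_X_sq k
  have h3 : ∫ ω, holderConst α (ε k ω) ^ 2 ∂P = ∫ ω, holderConst α (ε 0 ω) ^ 2 ∂P :=
    ((hhilbert.identDistrib_ε k).comp hm).integral_eq
  refine ⟨hind.integrable_mul h1 h2, ?_⟩
  rw [← h3, ← hmodel.integral_norm_X_sq k]
  exact hind.integral_mul_eq_mul_integral h1.1 h2.1

variable [SecondCountableTopology H]

/-- The later error is centred and independent of `(ε j, X j, X k)`, so it factors out of the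
expectation. -/
theorem HilbertSetting.integral_inner_ε_smul_X (hmodel : LinearModel P ρ X Y ε)
    (hhilbert : HilbertSetting S P X ε) (t : unitInterval) {j k : ℤ} (hjk : j < k) :
    ∫ ω, inner ℝ (ε j ω t • X j ω) (ε k ω t • X k ω) ∂P = 0 := by
  have hmeas : Measurable fun p : C(unitInterval, ℝ) × H × H =>
      p.1 t * inner ℝ p.2.1 p.2.2 :=
    ((measurable_eval t).comp measurable_fst).mul
      ((measurable_fst.comp measurable_snd).inner (measurable_snd.comp measurable_snd))
  have hmp : Measurable fun ω => (ε j ω, X j ω, X k ω) :=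
    (hmodel.measurable_ε j).prodMk ((hmodel.measurable_X j).prodMk (hmodel.measurable_X k))
  have h := ((hmodel.indepFun_ε_past hjk).comp (measurable_eval t)
    hmeas).integral_mul_eq_mul_integral
    ((measurable_eval t).comp (hmodel.measurable_ε k)).aestronglyMeasurable
    (hmeas.comp hmp).aestronglyMeasurable
  have h0 : ∫ ω, ((fun f : C(unitInterval, ℝ) => f t) ∘ ε k) ω ∂P = 0 :=
    hhilbert.integral_ε_apply k t
  rw [h0, zero_mul] at h
  rw [← h]
  refine integral_congr_ae (Eventually.of_forall fun ω => ?_)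
  simp only [real_inner_smul_left, real_inner_smul_right, Pi.mul_apply, Function.comp_apply]

theorem HilbertSetting.memLp_two_ε_smul_X (hmodel : LinearModel P ρ X Y ε)
    (hhilbert : HilbertSetting S P X ε) (k : ℤ) (t : unitInterval) :
    MemLp (fun ω => ε k ω t • X k ω) 2 P ∧
      ∫ ω, ‖ε k ω t • X k ω‖ ^ 2 ∂P = (∫ ω, ε k ω t ^ 2 ∂P) * ∫ ω, ‖X k ω‖ ^ 2 ∂P :=
  memLp_two_smul_of_indepFun ((measurable_eval t).comp (hmodel.measurable_ε k))
    (hmodel.measurable_X k) (hhilbert.integrable_ε_apply_sq hmodel k t)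
    (hhilbert.integrable_norm_X_sq k) ((hmodel.indepFun_ε_X k).comp (measurable_eval t)
      measurable_id)

theorem HilbertSetting.integrable_norm_crossMean_sq (hmodel : LinearModel P ρ X Y ε)
    (hhilbert : HilbertSetting S P X ε) (n : ℕ) (t : unitInterval) :
    Integrable (fun ω => ‖(n : ℝ)⁻¹ • ∑ k ∈ Finset.Icc (1 : ℤ) n, ε k ω t • X k ω‖ ^ 2) P :=
  ((memLp_finsetSum _ fun k _ => (hhilbert.memLp_two_ε_smul_X hmodel k t).1).const_smul
    ((n : ℝ)⁻¹)).integrable_norm_pow two_ne_zero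

theorem HilbertSetting.integral_norm_crossMean_sq_le (hmodel : LinearModel P ρ X Y ε)
    (hhilbert : HilbertSetting S P X ε) (n : ℕ) (t : unitInterval) :
    ∫ ω, ‖(n : ℝ)⁻¹ • ∑ k ∈ Finset.Icc (1 : ℤ) n, ε k ω t • X k ω‖ ^ 2 ∂P
      ≤ (n : ℝ)⁻¹ * ((∫ ω, ‖ε 0 ω‖ ^ 2 ∂P) * ∫ ω, ‖X 0 ω‖ ^ 2 ∂P) := by
  have hX0 : 0 ≤ ∫ ω, ‖X 0 ω‖ ^ 2 ∂P := integral_nonneg fun _ => sq_nonneg _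
  have hsum := integral_norm_sum_sq_of_orthogonal (P := P) (Finset.Icc (1 : ℤ) n)
    (D := fun k ω => ε k ω t • X k ω) (fun k => (hhilbert.memLp_two_ε_smul_X hmodel k t).1)
    fun j k hjk => by
      rcases lt_or_gt_of_ne hjk with h | h
      · exact hhilbert.integral_inner_ε_smul_X hmodel t h
      · simp_rw [fun ω => real_inner_comm (ε k ω t • X k ω) (ε j ω t • X j ω)]
        exact hhilbert.integral_inner_ε_smul_X hmodel t h
  have hle : ∑ k ∈ Finset.Icc (1 : ℤ) n, ∫ ω, ‖ε k ω t • X k ω‖ ^ 2 ∂P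
      ≤ n * ((∫ ω, ‖ε 0 ω‖ ^ 2 ∂P) * ∫ ω, ‖X 0 ω‖ ^ 2 ∂P) := by
    have h := Finset.sum_le_card_nsmul (Finset.Icc (1 : ℤ) n)
      (fun k => ∫ ω, ‖ε k ω t • X k ω‖ ^ 2 ∂P)
      ((∫ ω, ‖ε 0 ω‖ ^ 2 ∂P) * ∫ ω, ‖X 0 ω‖ ^ 2 ∂P) fun k _ => by
        rw [(hhilbert.memLp_two_ε_smul_X hmodel k t).2, hmodel.integral_norm_X_sq k]
        exact mul_le_mul_of_nonneg_right (hhilbert.integral_ε_apply_sq_le hmodel k t) hX0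
    simpa using h
  simp_rw [norm_smul, mul_pow]
  rw [integral_const_mul, hsum]
  rcases Nat.eq_zero_or_pos n with rfl | hn
  · simp
  have hn0 : (0 : ℝ) < n := by exact_mod_cast hn
  rw [Real.norm_of_nonneg (by positivity : (0 : ℝ) ≤ (n : ℝ)⁻¹)]
  calc _ ≤ (n : ℝ)⁻¹ ^ 2 * (n * ((∫ ω, ‖ε 0 ω‖ ^ 2 ∂P) * ∫ ω, ‖X 0 ω‖ ^ 2 ∂P)) := by gcongr
    _ = _ := by field_simp

/-- The random bound of `norm_crossMean_sq_le` for the model errors. -/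
def crossBound (X : ℤ → Ω → H) (ε : ℤ → Ω → C(unitInterval, ℝ)) (α : ℝ) (n N : ℕ) (ω : Ω) : ℝ :=
  2 * ∑ i ∈ Finset.range (N + 1),
      ‖(n : ℝ)⁻¹ • ∑ k ∈ Finset.Icc (1 : ℤ) n, ε k ω (gridPoint N i) • X k ω‖ ^ 2
    + 2 * (((N : ℝ)⁻¹ ^ α) ^ 2
      * ((n : ℝ)⁻¹ * ∑ k ∈ Finset.Icc (1 : ℤ) n, holderConst α (ε k ω) ^ 2 * ‖X k ω‖ ^ 2))

theorem HolderSetting.integrable_crossBound (hmodel : LinearModel P ρ X Y ε)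
    (hhilbert : HilbertSetting S P X ε) (hholder : HolderSetting P ρ X ε α) (n N : ℕ) :
    Integrable (crossBound X ε α n N) P :=
  ((integrable_finsetSum _ fun i _ =>
      hhilbert.integrable_norm_crossMean_sq hmodel n (gridPoint N i)).const_mul 2).add
    ((((integrable_finsetSum _ fun k _ =>
      (hholder.integral_holderConst_sq_mul hmodel hhilbert k).1).const_mul _).const_mul _).const_mul
        2)

theorem HolderSetting.integral_crossBound_le (hmodel : LinearModel P ρ X Y ε)
    (hhilbert : HilbertSetting S P X ε) (hholder : HolderSetting P ρ X ε α) {n : ℕ} (hn : 1 ≤ n)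
    (N : ℕ) :
    ∫ ω, crossBound X ε α n N ω ∂P
      ≤ 2 * ((N + 1) * (n : ℝ)⁻¹ * ((∫ ω, ‖ε 0 ω‖ ^ 2 ∂P) * ∫ ω, ‖X 0 ω‖ ^ 2 ∂P))
        + 2 * (((N : ℝ)⁻¹ ^ α) ^ 2
          * ((∫ ω, holderConst α (ε 0 ω) ^ 2 ∂P) * ∫ ω, ‖X 0 ω‖ ^ 2 ∂P)) := by
  have hn0 : (n : ℝ) ≠ 0 := by exact_mod_cast (by omega : n ≠ 0)
  have hi1 : ∀ i ∈ Finset.range (N + 1), Integrable (fun ω =>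
      ‖(n : ℝ)⁻¹ • ∑ k ∈ Finset.Icc (1 : ℤ) n, ε k ω (gridPoint N i) • X k ω‖ ^ 2) P :=
    fun i _ => hhilbert.integrable_norm_crossMean_sq hmodel n (gridPoint N i)
  have hi2 : ∀ k ∈ Finset.Icc (1 : ℤ) n,
      Integrable (fun ω => holderConst α (ε k ω) ^ 2 * ‖X k ω‖ ^ 2) P :=
    fun k _ => (hholder.integral_holderConst_sq_mul hmodel hhilbert k).1
  unfold crossBound
  rw [integral_add ((integrable_finsetSum _ hi1).const_mul 2)
    ((((integrable_finsetSum _ hi2).const_mul _).const_mul _).const_mul 2),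
    integral_const_mul, integral_const_mul, integral_const_mul, integral_const_mul,
    integral_finsetSum _ hi1, integral_finsetSum _ hi2]
  refine add_le_add (mul_le_mul_of_nonneg_left ?_ zero_le_two) (le_of_eq ?_)
  · have h := Finset.sum_le_card_nsmul (Finset.range (N + 1)) _ _ fun i _ =>
      hhilbert.integral_norm_crossMean_sq_le hmodel n (gridPoint N i)
    rw [Finset.card_range, nsmul_eq_mul, ← mul_assoc] at h
    exact_mod_cast h
  · rw [Finset.sum_congr rfl fun k _ =>
      (hholder.integral_holderConst_sq_mul hmodel hhilbert k).2, Finset.sum_const, Int.card_Icc,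
      add_sub_cancel_right, Int.toNat_natCast, nsmul_eq_mul, inv_mul_cancel_left₀ hn0]

/-- With `q = √n` and `N = ⌊√n⌋ + 1`, the grid term is at most `3 / q` and the Hölder term at most
`q^(-2α)`; both are at most a constant times `q^(-α) = n^(-α/2)`, using `α ≤ 1` for the first. -/
theorem mul_grid_rate_le {α : ℝ} (hα0 : 0 < α) (hα1 : α ≤ 1) {n : ℕ} (hn : 1 ≤ n) {a b : ℝ}
    (ha : 0 ≤ a) (hb : 0 ≤ b) :
    2 * (((Nat.sqrt n + 1 : ℕ) + 1) * (n : ℝ)⁻¹ * a)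
        + 2 * ((((Nat.sqrt n + 1 : ℕ) : ℝ)⁻¹ ^ α) ^ 2 * b)
      ≤ (6 * a + 2 * b) * ((n : ℝ) ^ (α / 2))⁻¹ := by
  have hn1 : (1 : ℝ) ≤ n := by exact_mod_cast hn
  have hn0 : (0 : ℝ) < n := by linarith
  set q : ℝ := √n
  have hq1 : 1 ≤ q := Real.one_le_sqrt.2 hn1
  have hqq : q * q = n := Real.mul_self_sqrt hn0.le
  have h1 : ((Nat.sqrt n : ℕ) : ℝ) ≤ q := Real.nat_sqrt_le_real_sqrt
  have h2 : q ≤ ((Nat.sqrt n + 1 : ℕ) : ℝ) := by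
    exact_mod_cast Real.real_sqrt_le_nat_sqrt_succ
  have hqpow : (n : ℝ) ^ (α / 2) = q ^ α := by
    rw [← hqq, Real.mul_rpow (by linarith) (by linarith), ← Real.rpow_add (by linarith)]
    congr 1
    ring
  rw [hqpow]
  have hqα : 0 < q ^ α := Real.rpow_pos_of_pos (by linarith) α
  have hqα1 : 1 ≤ q ^ α := Real.one_le_rpow hq1 hα0.le
  have hqαq : q ^ α ≤ q := by
    simpa using Real.rpow_le_rpow_of_exponent_le hq1 hα1
  have hA : (((Nat.sqrt n + 1 : ℕ) : ℝ) + 1) * (n : ℝ)⁻¹ ≤ 3 * (q ^ α)⁻¹ := by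
    have h3 : (((Nat.sqrt n + 1 : ℕ) : ℝ) + 1) ≤ 3 * q := by
      push_cast
      linarith
    calc _ ≤ 3 * q * (q * q)⁻¹ := by rw [hqq]; gcongr
      _ = 3 * q⁻¹ := by field_simp
      _ ≤ _ := by gcongr
  have hB : (((Nat.sqrt n + 1 : ℕ) : ℝ)⁻¹ ^ α) ^ 2 ≤ (q ^ α)⁻¹ := by
    have h3 : ((Nat.sqrt n + 1 : ℕ) : ℝ)⁻¹ ^ α ≤ (q ^ α)⁻¹ := by
      rw [← Real.inv_rpow (by linarith)]
      gcongr
    have h4 : (q ^ α)⁻¹ ≤ 1 := inv_le_one_of_one_le₀ hqα1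
    have h5 : 0 ≤ ((Nat.sqrt n + 1 : ℕ) : ℝ)⁻¹ ^ α := by positivity
    nlinarith
  have hA' := mul_le_mul_of_nonneg_right hA ha
  have hB' := mul_le_mul_of_nonneg_right hB hb
  linarith

/-- The eigensystems are chosen arbitrarily for each `ω`, so the supremum need not be measurable. It
is dominated by `crossBound`, which does not involve them and whose mean is explicit. -/
theorem HolderSetting.tendstoInMeasure_errorKernel [CompleteSpace H]
    (hmodel : LinearModel P ρ X Y ε)
    (hhilbert : HilbertSetting S P X ε) (hholder : HolderSetting P ρ X ε α) (hα0 : 0 < α)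
    (hα1 : α ≤ 1) {m : ℕ → ℝ} (hm_pos : ∀ n, 1 ≤ n → 0 < m n) (hm_top : Tendsto m atTop atTop)
    (hm_rate : Asymptotics.IsLittleO atTop m (fun n : ℕ => (n : ℝ) ^ (α / 2)))
    (E : ∀ (n : ℕ) (ω : Ω), EigenSystem (empCov (fun k => X k ω) (fun k => X k ω) n)) :
    TendstoInMeasure P
      (fun (n : ℕ) (ω : Ω) => ⨆ p : unitInterval × unitInterval,
        |errorKernel (fpcaEstimator (fun k => Y k ω) (fun k => X k ω) n (E n ω) (m n)) ρ
          (fun k => X k ω) n p.1 p.2|)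
      atTop (fun _ => (0 : ℝ)) := by
  set a := (∫ ω, ‖ε 0 ω‖ ^ 2 ∂P) * ∫ ω, ‖X 0 ω‖ ^ 2 ∂P
  set b := (∫ ω, holderConst α (ε 0 ω) ^ 2 ∂P) * ∫ ω, ‖X 0 ω‖ ^ 2 ∂P
  have ha : 0 ≤ a := mul_nonneg (integral_nonneg fun _ => sq_nonneg _)
    (integral_nonneg fun _ => sq_nonneg _)
  have hb : 0 ≤ b := mul_nonneg (integral_nonneg fun _ => sq_nonneg _)
    (integral_nonneg fun _ => sq_nonneg _)
  have hint : ∀ n N, Integrable (crossBound X ε α n N) P :=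
    fun n N => hholder.integrable_crossBound hmodel hhilbert n N
  have hnn : ∀ n N ω, 0 ≤ crossBound X ε α n N ω := fun n N ω => by
    unfold crossBound
    positivity
  refine tendstoInMeasure_zero_of_le
    (g := fun n ω => 2 * ((m n)⁻¹ * ‖ρ‖ ^ 2 + m n * crossBound X ε α n (Nat.sqrt n + 1) ω))
    (fun n ω => Real.iSup_nonneg fun _ => abs_nonneg _)
    (fun n => ((integrable_const _).add ((hint _ _).const_mul _)).const_mul 2) ?_ ?_
  · filter_upwards [eventually_ge_atTop 1] with n hn
    filter_upwards [hholder.ae_exists_holder_ε, ae_all_iff.2 hmodel.model] with ω hω hY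
    refine ciSup_le fun p => ?_
    refine abs_errorKernel_fpcaEstimator_le (E n ω) (hm_pos n hn) ρ (fun k => Y k ω)
      (fun k => ε k ω) hY (fun t => ?_) p.1 p.2
    refine norm_crossMean_sq_le (fun k => ε k ω) (fun k => X k ω) n (Nat.le_add_left _ _) hα0.le
      (fun k => holderConst_nonneg α (ε k ω)) (fun k t s => ?_) t
    obtain ⟨c, hc, h⟩ := hω k
    exact abs_sub_le_holderConst hc h t s
  · have hlim : Tendsto (fun n : ℕ => 2 * ((m n)⁻¹ * ‖ρ‖ ^ 2
        + (6 * a + 2 * b) * (m n / (n : ℝ) ^ (α / 2)))) atTop (𝓝 0) := by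
      have h1 := hm_top.inv_tendsto_atTop.mul_const (‖ρ‖ ^ 2)
      have h2 := hm_rate.tendsto_div_nhds_zero.const_mul (6 * a + 2 * b)
      simpa using (h1.add h2).const_mul 2
    refine tendsto_of_tendsto_of_tendsto_of_le_of_le' tendsto_const_nhds hlim ?_ ?_
    · filter_upwards [eventually_ge_atTop 1] with n hn
      have := (hm_pos n hn).le
      exact integral_nonneg fun ω => mul_nonneg zero_le_two (add_nonneg (by positivity)
        (mul_nonneg this (hnn _ _ _)))
    · filter_upwards [eventually_ge_atTop 1] with n hn
      rw [integral_const_mul, integral_add (integrable_const _) ((hint _ _).const_mul _),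
        integral_const_mul (m n)]
      have h1 := (hholder.integral_crossBound_le hmodel hhilbert hn (Nat.sqrt n + 1)).trans
        (mul_grid_rate_le hα0 hα1 hn ha hb)
      have h2 := mul_le_mul_of_nonneg_left h1 (hm_pos n hn).le
      have h3 : m n * ((6 * a + 2 * b) * ((n : ℝ) ^ (α / 2))⁻¹)
          = (6 * a + 2 * b) * (m n / (n : ℝ) ^ (α / 2)) := by
        rw [div_eq_mul_inv]
        ring
      rw [h3] at h2
      simp only [integral_const, probReal_univ, one_smul]
      linarith

end Consistency

end FReg

end

theorem propositionp
    {Ω : Type*} [MeasurableSpace Ω] (P : Measure Ω) [IsProbabilityMeasure P]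
    {H : Type*} [NormedAddCommGroup H] [InnerProductSpace ℝ H] [CompleteSpace H]
    [SecondCountableTopology H] [MeasurableSpace H] [BorelSpace H]
    {S : Type*} [MeasurableSpace S]
    (ρ : H →L[ℝ] C(unitInterval, ℝ)) (X : ℤ → Ω → H) (Y ε : ℤ → Ω → C(unitInterval, ℝ))
    (α : ℝ) (hα0 : 0 < α) (hα1 : α ≤ 1)
    (hmodel : FReg.LinearModel P ρ X Y ε)
    (hhilbert : FReg.HilbertSetting S P X ε)
    (hholder : FReg.HolderSetting P ρ X ε α)
    (m : ℕ → ℝ) (hm_pos : ∀ n, 1 ≤ n → 0 < m n) (hm_top : Tendsto m atTop atTop)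
    (hm_rate : Asymptotics.IsLittleO atTop m (fun n : ℕ => (n : ℝ) ^ (α / 2)))
    (E : ∀ (n : ℕ) (ω : Ω),
      FReg.EigenSystem (FReg.empCov (fun k => X k ω) (fun k => X k ω) n))
    (ρhat : ℕ → Ω → H →L[ℝ] C(unitInterval, ℝ))
    (hρhat : ∀ n ω, ρhat n ω =
      FReg.fpcaEstimator (fun k => Y k ω) (fun k => X k ω) n (E n ω) (m n)) :
    TendstoInMeasure P
      (fun (n : ℕ) (ω : Ω) => ⨆ p : unitInterval × unitInterval,
        |FReg.errorKernel (ρhat n ω) ρ (fun k => X k ω) n p.1 p.2|)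
      atTop (fun _ => (0 : ℝ)) ∧
    ∃ M : Ω → ℝ, Measurable M ∧ (∀ ω, 0 < M ω) ∧ Integrable M P ∧
      ∀ᵐ ω ∂P, ∀ n : ℕ, 1 ≤ n → ∀ t s : unitInterval, t ≠ s →
        FReg.incrementVar (ρhat n ω) (fun k => Y k ω) (fun k => X k ω) n t s <
          M ω ^ 2 * |(t : ℝ) - s| ^ (2 * α) := by
  obtain rfl : ρhat = fun n ω =>
      FReg.fpcaEstimator (fun k => Y k ω) (fun k => X k ω) n (E n ω) (m n) := by
    funext n ω
    exact hρhat n ω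
  exact ⟨hholder.tendstoInMeasure_errorKernel hmodel hhilbert hα0 hα1 hm_pos hm_top hm_rate E,
    hholder.exists_incrementVar_lt hmodel hhilbert hm_pos E⟩
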